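/- **Definitions.** An *LD-system* is a set $X$ with a binary operation $*$ satisfying $x*(y*z)=(x*y)*(x*z)$; omitted parentheses are grouped to the left. It is *acyclic* if there are no $n\ge 1$ and $x,x_1,\dots,x_n\in X$ with $x*x_1*\cdots*x_n=x$. Let $\mathrm{Li}(X)=\{x\in X: x*y=y\text{ for all }y\in X\}$, and let $t_1(x,y)=y$, $t_2(x,y)=x$, $t_{n+2}(x,y)=t_{n+1}(x,y)*t_n(x,y)$. The LD-system $X$ is *permutative* if $x*y\in\mathrm{Li}(X)$ for all $x\in X$, $y\in\mathrm{Li}(X)$, and for all $x,y\in X$ there is $n\ge1$ with $t_n(x,y)\in\mathrm{Li}(X)$; it is *reduced* if in addition $\mathrm{Li}(X)$ has exactly one element. In a reduced permutative LD-system, $x\circ y:=t_{n+1}(x,y)$ for any $n\ge1$ with $t_n(x,y)\in\mathrm{Li}(X)$. An *LD-monoid* is an algebra $(X,*,\circ,1)$ such that $(X,\circ,1)$ is a monoid and $(x\circ y)*z=x*(y*z)$, $x*(y\circ z)=(x*y)\circ(x*z)$, $x\circ y=(x*y)\circ x$, $1*x=x$, $x*1=1$. Let $X$ be a permutative LD-system.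 Put $x^0*y=y$, $x^{n+1}*y=x*(x^n*y)$, and write $\mathrm{crit}(x)\le\mathrm{crit}(y)$ if $x^n*y\in\mathrm{Li}(X)$ for some $n\ge0$. This is a preorder on $X$; $\mathrm{crit}(x)$ is the class of $x$ under the associated equivalence relation, and $\mathrm{crit}[X]$ is the ordered set of these classes. It has a greatest element, the class $\mathrm{Li}(X)$. Put $x^\sharp(\mathrm{crit}(r))=\mathrm{crit}(x*r)$. For $\alpha\in\mathrm{crit}[X]$ let $x\equiv^\alpha y$ mean $r*x=r*y$, where $r$ is any element with $\mathrm{crit}(r)=\alpha$ and $r*r\in\mathrm{Li}(X)$. Let $\mathcal X=((X_n)_{n\in\omega},(\phi_n)_{n\in\omega})$ be an inverse system of permutative LD-systems with homomorphisms $\phi_n:X_{n+1}\to X_n$, and let $\phi_{m,n}:X_m\to X_n$ $(m\ge n)$ be the transitional maps. It is *vast* if (i) for each $n$ there is $\alpha_n\in\mathrm{crit}[X_{n+1}]$ such that $\ker\phi_n$ is $\equiv^{\alpha_n}$, and (ii) for all $n$ and $x,y\in X_n$ there are $m\ge n$ and $x',y'\in X_m$ with $\phi_{m,n}(x')=x$,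 $\phi_{m,n}(y')=y$ and $x'*y'\notin\mathrm{Li}(X_m)$. In this case $\mathrm{crit}[X_n]$ is identified with an initial segment of $\mathrm{crit}[X_{n+1}]$: $\mathrm{crit}(\phi_n(x))$ is identified with $\mathrm{crit}(x)$ if $\phi_n(x)\notin\mathrm{Li}(X_n)$, and $\max\mathrm{crit}[X_n]$ with $\alpha_n$. Put $\mathrm{crit}[\mathcal X]=\bigcup_n\mathrm{crit}[X_n]$. Give each $X_n$ the discrete topology and $\varprojlim X_n$ the inverse limit topology and the coordinatewise operations. Let $\mathrm{EE}(\mathcal X)$ be the set of all threads $(x_n)_n\in\varprojlim X_n$ such that for every $\alpha\in\mathrm{crit}[\mathcal X]$ there is $m$ with $\alpha\in\mathrm{crit}[X_m]$ and $x_m^\sharp(\alpha)<\max\mathrm{crit}[X_m]$, and let $\mathrm{EE}(\mathcal X)^+$ be the set of those $(x_n)_n\in\mathrm{EE}(\mathcal X)$ with $x_n\notin\mathrm{Li}(X_n)$ for some $n$. **Proposition.** Let $\mathcal X$ be a vast inverse system of permutative LD-systems. 1. $\mathrm{EE}(\mathcal X)$ is a dense $G_\delta$ subset of $\varprojlim X_n$,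 and $\mathrm{EE}(\mathcal X)^+$ is a dense open subset of the space $\mathrm{EE}(\mathcal X)$. 2. $\mathrm{EE}(\mathcal X)$ and $\mathrm{EE}(\mathcal X)^+$ are closed under $*$. If each $X_n$ is reduced, then $\mathrm{EE}(\mathcal X)$ and $\mathrm{EE}(\mathcal X)^+$ are closed under the coordinatewise operation $\circ$. 3. $(\mathrm{EE}(\mathcal X)^+,*)$ is an acyclic LD-system. 4. Every element of $\mathrm{EE}(\mathcal X)^+$ freely generates a sub-LD-system of $(\mathrm{EE}(\mathcal X)^+,*)$. Furthermore, if each $X_n$ is an LD-monoid whose underlying LD-system is reduced (and permutative) and the $\phi_n$ are homomorphisms of LD-monoids, then $\mathrm{EE}(\mathcal X)$ is a sub-LD-monoid of $\varprojlim X_n$, and every element of $\mathrm{EE}(\mathcal X)\setminus\{1\}$ freely generates a sub-LD-monoid of $(\mathrm{EE}(\mathcal X),*,\circ,1)$. -/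

import Mathlib

open scoped Quandles

universe u v

/-! ## LD-systems

An LD-system is a set with a binary operation satisfying `x ◃ (y ◃ z) = (x ◃ y) ◃ (x ◃ z)`.
This is what Mathlib calls a `Shelf`; homomorphisms of LD-systems are `ShelfHom`s, written `→◃`.
Note that `◃` associates to the right, while in the literature omitted parentheses of the
operation of an LD-system are grouped to the left. -/

namespace LD

section Basic

variable {X : Type u} [Shelf X]

variable (X) in
/-- The set of left identities of an LD-system. -/
def leftIds : Set X := {x | ∀ y, x ◃ y = y}

/-- The Fibonacci terms: `fib x y n` is the term usually written `t_{n+1}(x, y)`, that is,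
`t_1(x, y) = y`, `t_2(x, y) = x` and `t_{n+2}(x, y) = t_{n+1}(x, y) * t_n(x, y)`. -/
def fib (x y : X) : ℕ → X
  | 0 => y
  | 1 => x
  | n + 2 => fib x y (n + 1) ◃ fib x y n

/-- `pw x n y` is `x ^ n * y`, that is, `x * (x * (... * (x * y)))` with `n` occurrences
of `x`. -/
def pw (x : X) : ℕ → X → X
  | 0, y => y
  | n + 1, y => x ◃ pw x n y

variable (X) in
/-- An LD-system is acyclic if `x * x₁ * ... * xₙ ≠ x` (parentheses grouped to the left)
for all `n ≥ 1` and all elements `x, x₁, ..., xₙ`. -/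
def IsAcyclic : Prop :=
  ∀ (x : X) (l : List X), l ≠ [] → l.foldl (fun a b => a ◃ b) x ≠ x

end Basic

/-- Permutative LD-systems. -/
class IsPermutative (X : Type u) [Shelf X] : Prop where
  act_mem_leftIds : ∀ x y : X, y ∈ leftIds X → x ◃ y ∈ leftIds X
  exists_fib_mem : ∀ x y : X, ∃ n, fib x y n ∈ leftIds X

/-- An LD-system is reduced if it has exactly one left identity. -/
def IsReduced (X : Type u) [Shelf X] : Prop := ∃! e : X, e ∈ leftIds X

/-! ## Critical points -/

section Crit

variable {X : Type u} [Shelf X]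

/-- The relation `crit x ≤ crit y`. -/
def critLE (x y : X) : Prop := ∃ n, pw x n y ∈ leftIds X

theorem act_pw (a x y : X) (n : ℕ) : a ◃ pw x n y = pw (a ◃ x) n (a ◃ y) := by
  induction n with
  | zero => rfl
  | succ n ih => simp only [pw]; rw [Shelf.self_distrib, ih]

theorem pw_pw (a x y : X) (k n : ℕ) : pw a k (pw x n y) = pw (pw a k x) n (pw a k y) := by
  induction k with
  | zero => rfl
  | succ k ih => simp only [pw]; rw [ih, act_pw]

theorem pw_add (x y : X) (m n : ℕ) : pw x (m + n) y = pw x m (pw x n y) := by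
  induction m with
  | zero => simp [pw]
  | succ m ih => rw [Nat.succ_add]; simp only [pw]; rw [ih]

theorem pw_leftId {a : X} (h : a ∈ leftIds X) (n : ℕ) (y : X) : pw a n y = y := by
  induction n with
  | zero => rfl
  | succ n ih => simp only [pw]; rw [ih, h y]

/-- Every term `t` in one variable `x` satisfies `t * x ^ [n] = x ^ [n+1]` and
`t ^ [n] = x ^ [n+c]` for some constant `c` and all large `n`, where `x ^ [n]` are the right
powers; this is the statement for the Fibonacci terms. -/
theorem fib_self_pw (x : X) (m : ℕ) : ∃ N c, ∀ n, N ≤ n →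
    fib x x m ◃ pw x n x = pw x (n + 1) x ∧
      pw (fib x x m) n (fib x x m) = pw x (n + c) x := by
  induction m using Nat.twoStepInduction with
  | zero => exact ⟨0, 0, fun n _ => ⟨rfl, rfl⟩⟩
  | one => exact ⟨0, 0, fun n _ => ⟨rfl, rfl⟩⟩
  | more m iha ihb =>
    obtain ⟨N, c, h⟩ := iha
    obtain ⟨M, d, k⟩ := ihb
    refine ⟨N + M + 1, c + 1, fun n hn => ?_⟩
    obtain ⟨n, rfl⟩ : ∃ p, n = p + 1 := ⟨n - 1, by omega⟩
    simp only [fib]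
    constructor
    · have e1 := (h n (by omega)).1
      rw [← (k n (by omega)).1, ← Shelf.self_distrib, e1, (k (n + 1) (by omega)).1]
    · rw [← act_pw, (h (n + 1) (by omega)).2, (k (n + 1 + c) (by omega)).1]
      rfl

variable [IsPermutative X]

theorem pw_mem_leftIds (x : X) {y : X} (h : y ∈ leftIds X) (n : ℕ) : pw x n y ∈ leftIds X := by
  induction n with
  | zero => exact h
  | succ n ih => exact IsPermutative.act_mem_leftIds _ _ ih

theorem critLE_refl (x : X) : critLE x x := by
  obtain ⟨m, hm⟩ := IsPermutative.exists_fib_mem x x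
  obtain ⟨N, c, h⟩ := fib_self_pw x m
  exact ⟨N + c, by rw [← (h N le_rfl).2, pw_leftId hm]; exact hm⟩

theorem critLE_trans {x y z : X} (hxy : critLE x y) (hyz : critLE y z) : critLE x z := by
  obtain ⟨m, hm⟩ := hxy
  obtain ⟨n, hn⟩ := hyz
  exact ⟨m, by
    have h := pw_mem_leftIds x hn m
    rwa [pw_pw, pw_leftId hm] at h⟩

theorem critLE_act (r : X) {x y : X} (h : critLE x y) : critLE (r ◃ x) (r ◃ y) := by
  obtain ⟨n, hn⟩ := h
  exact ⟨n, by rw [← act_pw]; exact IsPermutative.act_mem_leftIds _ _ hn⟩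

variable (X) in
/-- The equivalence relation `crit x = crit y`. -/
def critSetoid : Setoid X where
  r x y := critLE x y ∧ critLE y x
  iseqv := ⟨fun x => ⟨critLE_refl x, critLE_refl x⟩, fun h => ⟨h.2, h.1⟩,
    fun h k => ⟨critLE_trans h.1 k.1, critLE_trans k.2 h.2⟩⟩

variable (X) in
/-- The set `crit[X]` of critical points of a permutative LD-system. -/
def Crit : Type u := Quotient (critSetoid X)

/-- The critical point of an element. -/
def crit (x : X) : Crit X := Quotient.mk (critSetoid X) x

instance : PartialOrder (Crit X) where
  le := Quotient.lift₂ critLE fun _ _ _ _ h k => propext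
    ⟨fun l => critLE_trans h.2 (critLE_trans l k.1),
      fun l => critLE_trans h.1 (critLE_trans l k.2)⟩
  le_refl := by rintro ⟨x⟩; exact critLE_refl x
  le_trans := by rintro ⟨x⟩ ⟨y⟩ ⟨z⟩ h k; exact critLE_trans h k
  le_antisymm := by rintro ⟨x⟩ ⟨y⟩ h k; exact Quotient.sound ⟨h, k⟩

theorem crit_le_crit {x y : X} : crit x ≤ crit y ↔ critLE x y := Iff.rfl

/-- The map `x ^ ♯ : crit[X] → crit[X]`, `crit r ↦ crit (x * r)`. -/
def sharp (x : X) : Crit X → Crit X :=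
  Quotient.map (sa := critSetoid X) (sb := critSetoid X) (fun r => x ◃ r)
    fun _ _ h => ⟨critLE_act x h.1, critLE_act x h.2⟩

/-- `α < max(crit[X])`. -/
def BelowMax (α : Crit X) : Prop := ∃ μ : Crit X, IsTop μ ∧ α < μ

/-- The congruence `x ≡^α y`: one has `r * x = r * y` where `r` is an element with
`crit r = α` and `r * r` a left identity. (Such an `r` exists, and the relation does not depend
on its choice.) -/
def EquivAt (α : Crit X) (x y : X) : Prop :=
  ∃ r : X, r ◃ r ∈ leftIds X ∧ crit r = α ∧ r ◃ x = r ◃ y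

open Classical in
/-- The composition operation: `x ∘ y = t_{n+1}(x, y)` where `t_n(x, y)` is a left identity. (In
a reduced permutative LD-system this does not depend on the choice of `n`; we take the least
one.) -/
noncomputable def comp (x y : X) : X :=
  fib x y (Nat.find (IsPermutative.exists_fib_mem x y) + 1)

end Crit

/-! ## LD-monoids -/

/-- The structure of an LD-monoid on an LD-system `X`: a monoid structure (whose multiplication
is the operation `∘` of the LD-monoid) satisfying the LD-monoid identities. -/
class LDMonoid (X : Type u) [Shelf X] extends Monoid X where
  mul_act : ∀ x y z : X, (x * y) ◃ z = x ◃ (y ◃ z)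
  act_mul : ∀ x y z : X, x ◃ (y * z) = (x ◃ y) * (x ◃ z)
  mul_eq_act_mul : ∀ x y : X, x * y = (x ◃ y) * x
  one_act : ∀ x : X, (1 : X) ◃ x = x
  act_one : ∀ x : X, x ◃ (1 : X) = 1

/-- A homomorphism of LD-systems between LD-monoids that is a homomorphism of LD-monoids. -/
class IsLDMonoidHom {X : Type u} {Y : Type v} [Shelf X] [Shelf Y] [LDMonoid X] [LDMonoid Y]
    (f : X →◃ Y) : Prop where
  map_one : f 1 = 1
  map_mul : ∀ x y, f (x * y) = f x * f y

/-! ## Subalgebras -/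

/-- A sub-LD-system. -/
structure SubLDSystem (X : Type u) [Shelf X] where
  carrier : Set X
  act_mem : ∀ {x y}, x ∈ carrier → y ∈ carrier → x ◃ y ∈ carrier

instance (X : Type u) [Shelf X] (S : SubLDSystem X) : Shelf S.carrier where
  act x y := ⟨x.1 ◃ y.1, S.act_mem x.2 y.2⟩
  self_distrib := Subtype.ext Shelf.self_distrib

/-- A sub-LD-monoid. -/
structure SubLDMonoid (X : Type u) [Shelf X] [LDMonoid X] extends SubLDSystem X where
  one_mem : 1 ∈ carrier
  mul_mem : ∀ {x y}, x ∈ carrier → y ∈ carrier → x * y ∈ carrier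

instance (X : Type u) [Shelf X] [LDMonoid X] (S : SubLDMonoid X) : LDMonoid S.carrier where
  mul x y := ⟨x.1 * y.1, S.mul_mem x.2 y.2⟩
  one := ⟨1, S.one_mem⟩
  mul_assoc x y z := Subtype.ext (mul_assoc x.1 y.1 z.1)
  one_mul x := Subtype.ext (one_mul x.1)
  mul_one x := Subtype.ext (mul_one x.1)
  mul_act x y z := Subtype.ext (LDMonoid.mul_act x.1 y.1 z.1)
  act_mul x y z := Subtype.ext (LDMonoid.act_mul x.1 y.1 z.1)
  mul_eq_act_mul x y := Subtype.ext (LDMonoid.mul_eq_act_mul x.1 y.1)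
  one_act x := Subtype.ext (LDMonoid.one_act x.1)
  act_one x := Subtype.ext (LDMonoid.act_one x.1)

/-! ## Free LD-systems and free LD-monoids -/

/-- Terms in the language of LD-systems over a set of variables. -/
inductive Term (ι : Type v) : Type v
  | var : ι → Term ι
  | act : Term ι → Term ι → Term ι

/-- The congruence on terms generated by the self-distributivity identity. -/
inductive Term.Eqv {ι : Type v} : Term ι → Term ι → Prop
  | refl (a) : Eqv a a
  | symm {a b} : Eqv a b → Eqv b a
  | trans {a b c} : Eqv a b → Eqv b c → Eqv a c
  | act {a b c d} : Eqv a b → Eqv c d → Eqv (.act a c) (.act b d)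
  | ld (a b c) : Eqv (.act a (.act b c)) (.act (.act a b) (.act a c))

/-- The value of a term in an LD-system. -/
def Term.eval {ι : Type v} {X : Type u} [Shelf X] (g : ι → X) : Term ι → X
  | .var i => g i
  | .act s t => s.eval g ◃ t.eval g

theorem Term.Eqv.eval_eq {ι : Type v} {X : Type u} [Shelf X] (g : ι → X) {s t : Term ι}
    (h : Term.Eqv s t) : s.eval g = t.eval g := by
  induction h with
  | refl => rfl
  | symm _ ih => exact ih.symm
  | trans _ _ ih jh => exact ih.trans jh
  | act _ _ ih jh => simp only [Term.eval]; rw [ih, jh]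
  | ld => exact Shelf.self_distrib

instance Term.setoid (ι : Type v) : Setoid (Term ι) where
  r := Term.Eqv
  iseqv := ⟨.refl, .symm, .trans⟩

/-- The free LD-system on a set. -/
def Free (ι : Type v) : Type v := Quotient (Term.setoid ι)

instance (ι : Type v) : Shelf (Free ι) where
  act := Quotient.map₂ Term.act fun _ _ h _ _ k => Term.Eqv.act h k
  self_distrib := by rintro ⟨a⟩ ⟨b⟩ ⟨c⟩; exact Quotient.sound (Term.Eqv.ld a b c)

/-- The generators of the free LD-system. -/
def Free.of {ι : Type v} (i : ι) : Free ι := Quotient.mk _ (Term.var i)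

/-- The homomorphism from the free LD-system that extends a map on the generators. -/
def Free.lift {ι : Type v} {X : Type u} [Shelf X] (g : ι → X) : Free ι →◃ X where
  toFun := Quotient.lift (Term.eval g) fun _ _ h => Term.Eqv.eval_eq g h
  map_act' := by rintro ⟨a⟩ ⟨b⟩; rfl

theorem Free.lift_of {ι : Type v} {X : Type u} [Shelf X] (g : ι → X) (i : ι) :
    Free.lift g (Free.of i) = g i := rfl

theorem Free.eq_lift {ι : Type v} {X : Type u} [Shelf X] (g : ι → X) (f : Free ι →◃ X)
    (h : ∀ i, f (Free.of i) = g i) : f = Free.lift g := by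
  apply DFunLike.ext
  rintro ⟨t⟩
  induction t with
  | var i => exact h i
  | act s t ihs iht =>
    exact (ShelfHom.map_act f (x := Quotient.mk _ s) (y := Quotient.mk _ t)).trans
      (congrArg₂ Shelf.act ihs iht)

/-- The family `g` freely generates a sub-LD-system of `X`: the canonical homomorphism from the
free LD-system (whose image is the sub-LD-system generated by `g`) is injective. -/
def FreelyGenerates {ι : Type v} {X : Type u} [Shelf X] (g : ι → X) : Prop :=
  Function.Injective (Free.lift g)

/-- Terms in the language of LD-monoids over a set of variables. -/
inductive MonTerm (ι : Type v) : Type v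
  | var : ι → MonTerm ι
  | one : MonTerm ι
  | act : MonTerm ι → MonTerm ι → MonTerm ι
  | mul : MonTerm ι → MonTerm ι → MonTerm ι

/-- The congruence on terms generated by the LD-monoid identities. -/
inductive MonTerm.Eqv {ι : Type v} : MonTerm ι → MonTerm ι → Prop
  | refl (a) : Eqv a a
  | symm {a b} : Eqv a b → Eqv b a
  | trans {a b c} : Eqv a b → Eqv b c → Eqv a c
  | act {a b c d} : Eqv a b → Eqv c d → Eqv (.act a c) (.act b d)
  | mul {a b c d} : Eqv a b → Eqv c d → Eqv (.mul a c) (.mul b d)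
  | mul_assoc (a b c) : Eqv (.mul (.mul a b) c) (.mul a (.mul b c))
  | one_mul (a) : Eqv (.mul .one a) a
  | mul_one (a) : Eqv (.mul a .one) a
  | mul_act (a b c) : Eqv (.act (.mul a b) c) (.act a (.act b c))
  | act_mul (a b c) : Eqv (.act a (.mul b c)) (.mul (.act a b) (.act a c))
  | mul_eq_act_mul (a b) : Eqv (.mul a b) (.mul (.act a b) a)
  | one_act (a) : Eqv (.act .one a) a
  | act_one (a) : Eqv (.act a .one) .one

/-- The value of a term in an LD-monoid. -/
def MonTerm.eval {ι : Type v} {X : Type u} [Shelf X] [LDMonoid X] (g : ι → X) : MonTerm ι → X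
  | .var i => g i
  | .one => 1
  | .act s t => s.eval g ◃ t.eval g
  | .mul s t => s.eval g * t.eval g

theorem MonTerm.Eqv.eval_eq {ι : Type v} {X : Type u} [Shelf X] [LDMonoid X] (g : ι → X)
    {s t : MonTerm ι} (h : MonTerm.Eqv s t) : s.eval g = t.eval g := by
  induction h with
  | refl => rfl
  | symm _ ih => exact ih.symm
  | trans _ _ ih jh => exact ih.trans jh
  | act _ _ ih jh => simp only [MonTerm.eval]; rw [ih, jh]
  | mul _ _ ih jh => simp only [MonTerm.eval]; rw [ih, jh]
  | mul_assoc => exact _root_.mul_assoc _ _ _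
  | one_mul => exact _root_.one_mul _
  | mul_one => exact _root_.mul_one _
  | mul_act => exact LDMonoid.mul_act _ _ _
  | act_mul => exact LDMonoid.act_mul _ _ _
  | mul_eq_act_mul => exact LDMonoid.mul_eq_act_mul _ _
  | one_act => exact LDMonoid.one_act _
  | act_one => exact LDMonoid.act_one _

instance MonTerm.setoid (ι : Type v) : Setoid (MonTerm ι) where
  r := MonTerm.Eqv
  iseqv := ⟨.refl, .symm, .trans⟩

/-- The free LD-monoid on a set. -/
def FreeMon (ι : Type v) : Type v := Quotient (MonTerm.setoid ι)

instance (ι : Type v) : Shelf (FreeMon ι) where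
  act := Quotient.map₂ MonTerm.act fun _ _ h _ _ k => MonTerm.Eqv.act h k
  self_distrib := by
    rintro ⟨a⟩ ⟨b⟩ ⟨c⟩
    exact Quotient.sound (.trans (.symm (.mul_act a b c))
      (.trans (.act (.mul_eq_act_mul a b) (.refl c)) (.mul_act (.act a b) a c)))

instance (ι : Type v) : LDMonoid (FreeMon ι) where
  mul := Quotient.map₂ MonTerm.mul fun _ _ h _ _ k => MonTerm.Eqv.mul h k
  one := Quotient.mk _ MonTerm.one
  mul_assoc := by rintro ⟨a⟩ ⟨b⟩ ⟨c⟩; exact Quotient.sound (.mul_assoc a b c)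
  one_mul := by rintro ⟨a⟩; exact Quotient.sound (.one_mul a)
  mul_one := by rintro ⟨a⟩; exact Quotient.sound (.mul_one a)
  mul_act := by rintro ⟨a⟩ ⟨b⟩ ⟨c⟩; exact Quotient.sound (.mul_act a b c)
  act_mul := by rintro ⟨a⟩ ⟨b⟩ ⟨c⟩; exact Quotient.sound (.act_mul a b c)
  mul_eq_act_mul := by rintro ⟨a⟩ ⟨b⟩; exact Quotient.sound (.mul_eq_act_mul a b)
  one_act := by rintro ⟨a⟩; exact Quotient.sound (.one_act a)
  act_one := by rintro ⟨a⟩; exact Quotient.sound (.act_one a)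

/-- The generators of the free LD-monoid. -/
def FreeMon.of {ι : Type v} (i : ι) : FreeMon ι := Quotient.mk _ (MonTerm.var i)

/-- The homomorphism from the free LD-monoid that extends a map on the generators. -/
def FreeMon.lift {ι : Type v} {X : Type u} [Shelf X] [LDMonoid X] (g : ι → X) :
    FreeMon ι →◃ X where
  toFun := Quotient.lift (MonTerm.eval g) fun _ _ h => MonTerm.Eqv.eval_eq g h
  map_act' := by rintro ⟨a⟩ ⟨b⟩; rfl

theorem FreeMon.lift_of {ι : Type v} {X : Type u} [Shelf X] [LDMonoid X] (g : ι → X) (i : ι) :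
    FreeMon.lift g (FreeMon.of i) = g i := rfl

instance {ι : Type v} {X : Type u} [Shelf X] [LDMonoid X] (g : ι → X) :
    IsLDMonoidHom (FreeMon.lift g) where
  map_one := rfl
  map_mul := by rintro ⟨a⟩ ⟨b⟩; rfl

/-- The family `g` freely generates a sub-LD-monoid of `X`: the canonical homomorphism from the
free LD-monoid (whose image is the sub-LD-monoid generated by `g`) is injective. -/
def FreelyGeneratesMon {ι : Type v} {X : Type u} [Shelf X] [LDMonoid X] (g : ι → X) : Prop :=
  Function.Injective (FreeMon.lift g)

/-! ## Inverse systems -/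

section Inverse

variable {X : ℕ → Type u} [∀ n, Shelf (X n)] (φ : ∀ n, X (n + 1) →◃ X n)

/-- The transitional map from `X (n + k)` to `X n`. -/
def trans (n : ℕ) : (k : ℕ) → X (n + k) → X n
  | 0, x => x
  | k + 1, x => trans n k (φ (n + k) x)

/-- The inverse limit: the set of all threads. -/
def InvLim : Type u := {x : ∀ n, X n // ∀ n, φ n (x (n + 1)) = x n}

/-- The inverse limit topology, where each `X n` is discrete. -/
instance : TopologicalSpace (InvLim φ) :=
  TopologicalSpace.induced (fun x : InvLim φ => x.1)
    (@Pi.topologicalSpace ℕ X fun _ => ⊥)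

instance : Shelf (InvLim φ) where
  act x y := ⟨fun n => x.1 n ◃ y.1 n, fun n => by rw [ShelfHom.map_act, x.2, y.2]⟩
  self_distrib := Subtype.ext (funext fun _ => Shelf.self_distrib)

instance [∀ n, LDMonoid (X n)] [∀ n, IsLDMonoidHom (φ n)] : LDMonoid (InvLim φ) where
  mul x y := ⟨fun n => x.1 n * y.1 n, fun n => by rw [IsLDMonoidHom.map_mul, x.2, y.2]⟩
  one := ⟨fun _ => 1, fun _ => IsLDMonoidHom.map_one⟩
  mul_assoc x y z := Subtype.ext (funext fun n => mul_assoc (x.1 n) (y.1 n) (z.1 n))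
  one_mul x := Subtype.ext (funext fun n => one_mul (x.1 n))
  mul_one x := Subtype.ext (funext fun n => mul_one (x.1 n))
  mul_act x y z := Subtype.ext (funext fun n => LDMonoid.mul_act (x.1 n) (y.1 n) (z.1 n))
  act_mul x y z := Subtype.ext (funext fun n => LDMonoid.act_mul (x.1 n) (y.1 n) (z.1 n))
  mul_eq_act_mul x y := Subtype.ext (funext fun n => LDMonoid.mul_eq_act_mul (x.1 n) (y.1 n))
  one_act x := Subtype.ext (funext fun n => LDMonoid.one_act (x.1 n))
  act_one x := Subtype.ext (funext fun n => LDMonoid.act_one (x.1 n))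

variable [∀ n, IsPermutative (X n)]

/-- The kernel of `φ n` is the congruence `≡^α`. -/
def KerEq (n : ℕ) (α : Crit (X (n + 1))) : Prop :=
  ∀ x y : X (n + 1), φ n x = φ n y ↔ EquivAt α x y

/-- Vast inverse systems of permutative LD-systems. -/
structure IsVast : Prop where
  exists_kerEq : ∀ n, ∃ α : Crit (X (n + 1)), KerEq φ n α
  exists_lift : ∀ n (x y : X n), ∃ (k : ℕ) (x' y' : X (n + k)),
    trans φ n k x' = x ∧ trans φ n k y' = y ∧ x' ◃ y' ∉ leftIds (X (n + k))

/-- The identification of the critical points of `X n` with those in an initial segment of the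
critical points of `X (n + 1)`: `crit (φ n x)` is identified with `crit x` whenever `φ n x` is not
a left identity, and the greatest critical point of `X n` is identified with the critical point
`α` for which the kernel of `φ n` is `≡^α`. -/
inductive CritStep : (Σ n, Crit (X n)) → (Σ n, Crit (X n)) → Prop
  | of_notMem (n : ℕ) (x : X (n + 1)) (h : φ n x ∉ leftIds (X n)) :
      CritStep ⟨n, crit (φ n x)⟩ ⟨n + 1, crit x⟩
  | of_isTop (n : ℕ) (μ : Crit (X n)) (α : Crit (X (n + 1))) (hμ : IsTop μ) (hα : KerEq φ n α) :
      CritStep ⟨n, μ⟩ ⟨n + 1, α⟩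

/-- The union of the sets `crit[X n]` under the above identifications. -/
def CritLim : Type u := Quot (CritStep φ)

/-- `EE` is the set of all threads `x` such that for each critical point `α` of the system there is
some `m` with `α ∈ crit[X m]` and `(x m) ^ ♯ (α) < max(crit[X m])`. -/
def EE : Set (InvLim φ) :=
  {x | ∀ α : CritLim φ, ∃ (m : ℕ) (β : Crit (X m)),
    Quot.mk (CritStep φ) ⟨m, β⟩ = α ∧ BelowMax (sharp (x.1 m) β)}

/-- `EE⁺` is the set of all threads in `EE` with some coordinate that is not a left identity. -/
def EEPlus : Set (InvLim φ) := {x | x ∈ EE φ ∧ ∃ n, x.1 n ∉ leftIds (X n)}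

end Inverse

end LD

namespace LD

/-! ### Fibonacci terms, composition, and the linear order on critical points. -/

section Permutative

variable {X : Type u} [Shelf X]

/-! Call a thread nontrivial if some coordinate is not a left identity. Everything about `EE`
follows from `IsVast.mem_EE_iff`: a thread lies in `EE` exactly when it sends nontrivial threads to
nontrivial threads. Closure under `∘` is then immediate from `(x ∘ y) * r = x * (y * r)`. Closure
under `*` follows from `(x * y) * (x * r) = x * (y * r)`, since acting never lowers critical points.
The criterion also presents `EE` as a countable intersection of open sets, each dense by vastness.
The inverse limit is closed in a countable product of discrete spaces, so Baire's theorem applies.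

Acyclicity reduces to one level. A cycle of left division in `EE⁺` involves finitely many nontrivial
threads, so at a high enough level it avoids left identities, against `exists_mem_leftIds_of_cycle`.
For the latter, start the cycle at an element `x₀` of greatest critical point, and suppose that it
is not a left identity. Let `β` be the least `crit (xᵢ * x₀)`, which exceeds `crit x₀`. Modulo `≡^β`
each later term has the form `x₀ * w`, hence so does `x₀` itself when the cycle closes. But `crit
(x₀ * w)` is never `crit x₀` (`crit_act_ne`).

Acyclicity gives freeness on one generator through the comparison property `Term.exists_leftSub_or`:
up to equivalence, of two terms one is an iterated left subterm of the other, so equal values would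
form a cycle unless the terms agree. Freeness transfers to LD-monoids because a product `a₁ ∘ ... ∘
aₖ` in the free LD-monoid can be recovered from `a₁ * (... * (aₖ * x))`, an element of the free
LD-system. -/

theorem act_fib (a x y : X) (n : ℕ) : a ◃ fib x y n = fib (a ◃ x) (a ◃ y) n := by
  induction n using Nat.twoStepInduction with
  | zero => rfl
  | one => rfl
  | more n ih jh => simp only [fib]; rw [Shelf.self_distrib, ih, jh]

theorem act_mem_leftIds_of_left {x y : X} (hx : x ∈ leftIds X) (hy : y ∈ leftIds X) :
    x ◃ y ∈ leftIds X := by rwa [hx y]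

theorem fib_mem_leftIds {x y : X} (hx : x ∈ leftIds X) (hy : y ∈ leftIds X) (n : ℕ) :
    fib x y n ∈ leftIds X := by
  induction n using Nat.twoStepInduction with
  | zero => exact hy
  | one => exact hx
  | more n ih jh => exact act_mem_leftIds_of_left jh ih

/-- Self-distributivity turns `t_{n+1} * (t_n * z)` into `t_{n+2} * (t_{n+1} * z)`, so the value
does not depend on `n`. Once `t_n` is a left identity, `t_{n+1}` therefore acts as `x` after `y`. -/
theorem fib_succ_act_fib_act (x y z : X) (n : ℕ) :
    fib x y (n + 1) ◃ (fib x y n ◃ z) = x ◃ (y ◃ z) := by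
  induction n with
  | zero => rfl
  | succ n ih => rw [← ih, Shelf.self_distrib (x := fib x y (n + 1))]; rfl

theorem fib_succ_act {x y : X} {n : ℕ} (h : fib x y n ∈ leftIds X) (z : X) :
    fib x y (n + 1) ◃ z = x ◃ (y ◃ z) := by
  rw [← fib_succ_act_fib_act x y z n, h z]

theorem act_act_self {r : X} (hr : r ◃ r ∈ leftIds X) (y : X) : r ◃ (r ◃ y) = r ◃ y := by
  rw [Shelf.self_distrib, hr]

variable [IsPermutative X]

theorem exists_leftId (x : X) : ∃ e : X, e ∈ leftIds X :=
  (IsPermutative.exists_fib_mem x x).elim fun _ h => ⟨_, h⟩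

theorem act_mem_leftIds (x : X) {y : X} (h : y ∈ leftIds X) : x ◃ y ∈ leftIds X :=
  IsPermutative.act_mem_leftIds x y h

/-- The composition powers of `x` are represented by elements of `X`. -/
theorem exists_act_eq_pw (x : X) (n : ℕ) :
    ∃ p : X, (∀ z, p ◃ z = pw x n z) ∧ ∀ a, a ◃ x ∈ leftIds X → a ◃ p ∈ leftIds X := by
  induction n with
  | zero =>
    obtain ⟨e, he⟩ := exists_leftId x
    exact ⟨e, he, fun a _ => act_mem_leftIds a he⟩
  | succ n ih =>
    obtain ⟨p, hp, hap⟩ := ih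
    obtain ⟨k, hk⟩ := IsPermutative.exists_fib_mem x p
    refine ⟨fib x p (k + 1), fun z => ?_, fun a ha => ?_⟩
    · rw [fib_succ_act hk, hp]; rfl
    · rw [act_fib]; exact fib_mem_leftIds ha (hap a ha) _

theorem crit_le_of_act_mem {x y : X} (h : x ◃ y ∈ leftIds X) : crit x ≤ crit y := ⟨1, h⟩

/-- Every critical point is represented by an element `r` such that `r * r` is a left identity. -/
theorem exists_crit_eq (x : X) : ∃ r : X, r ◃ r ∈ leftIds X ∧ crit r = crit x := by
  obtain ⟨m, hm⟩ := critLE_refl x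
  obtain ⟨p, hp, hap⟩ := exists_act_eq_pw x m
  have hpx : p ◃ x ∈ leftIds X := by rwa [hp]
  -- Here `p` acts as the `m`-th power of `x` and kills `x`. Whatever kills `x` kills `p`, so `p *
  -- p` is a left identity.
  exact ⟨p, hap p hpx, le_antisymm (crit_le_of_act_mem hpx) ⟨m, hp p ▸ hap p hpx⟩⟩

theorem exists_rep (α : Crit X) : ∃ r : X, r ◃ r ∈ leftIds X ∧ crit r = α := by
  obtain ⟨x, rfl⟩ := Quotient.exists_rep α
  exact exists_crit_eq x

theorem crit_le_iff {r : X} (hr : r ◃ r ∈ leftIds X) {y : X} :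
    crit r ≤ crit y ↔ r ◃ y ∈ leftIds X := by
  refine ⟨fun ⟨n, hn⟩ => ?_, crit_le_of_act_mem⟩
  have h : ∀ n, pw r (n + 1) y = r ◃ y := by
    intro n
    induction n with
    | zero => rfl
    | succ n ih => rw [pw, ih, act_act_self hr]
  rw [← h n]
  exact act_mem_leftIds r hn

/-- With `r` idempotent-like of the same critical point as `y`, `r * (x * r) = (r * x) * (r * r)` is
a left identity. -/
theorem crit_le_crit_act (x y : X) : crit y ≤ crit (x ◃ y) := by
  obtain ⟨r, hr, e⟩ := exists_crit_eq y
  rw [← e]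
  refine le_trans (crit_le_of_act_mem ?_) (critLE_act x (y := y) e.le)
  rw [Shelf.self_distrib]
  exact act_mem_leftIds _ hr

theorem crit_act_mono (x : X) {y z : X} (h : crit y ≤ crit z) : crit (x ◃ y) ≤ crit (x ◃ z) :=
  critLE_act x h

theorem crit_le_of_mem (x : X) {e : X} (h : e ∈ leftIds X) : crit x ≤ crit e := ⟨0, h⟩

theorem mem_of_crit_le {e x : X} (h : e ∈ leftIds X) (hx : crit e ≤ crit x) : x ∈ leftIds X := by
  obtain ⟨n, hn⟩ := hx
  rwa [pw_leftId h] at hn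

theorem crit_total (x y : X) : crit x ≤ crit y ∨ crit y ≤ crit x := by
  obtain ⟨n, hn⟩ := IsPermutative.exists_fib_mem x y
  -- Descending induction: comparability passes from consecutive Fibonacci terms to the preceding
  -- pair, starting at the left identity and ending at `x`, `y`.
  have key : ∀ k, k ≤ n → crit (fib x y (n - k + 1)) ≤ crit (fib x y (n - k)) ∨
      crit (fib x y (n - k)) ≤ crit (fib x y (n - k + 1)) := by
    intro k
    induction k with
    | zero => exact fun _ => .inl (crit_le_of_mem _ hn)
    | succ k ih =>
      intro hk
      obtain ⟨m, hm⟩ : ∃ m, n - k = m + 1 := ⟨n - k - 1, by omega⟩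
      rw [show n - (k + 1) = m by omega]
      rcases hm ▸ ih (by omega) with h | h
      · exact .inr (le_trans (crit_le_crit_act _ _) h)
      · obtain ⟨j, hj⟩ := h
        refine .inl ⟨j + 1, ?_⟩
        rw [pw_add]; exact hj
  simpa [fib] using key n le_rfl

noncomputable instance : LinearOrder (Crit X) where
  le_total := by rintro ⟨x⟩ ⟨y⟩; exact crit_total x y
  toDecidableLE := Classical.decRel _

/-- If the critical point did not grow, it would not grow under any power of `x`, yet some power
sends `y` to a left identity. -/
theorem crit_lt_crit_act {x y : X} (h : crit x ≤ crit y) (hy : y ∉ leftIds X) :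
    crit y < crit (x ◃ y) := by
  refine (crit_le_crit_act x y).lt_of_ne fun e => hy ?_
  obtain ⟨n, hn⟩ := h
  have h : ∀ n, crit (pw x n y) ≤ crit y := by
    intro n
    induction n with
    | zero => exact le_rfl
    | succ n ih => exact (crit_act_mono x ih).trans e.ge
  exact mem_of_crit_le hn (h n)

theorem lt_crit_act {x y z : X} (h : crit z < crit y) : crit z < crit (x ◃ y) :=
  h.trans_le (crit_le_crit_act x y)

theorem crit_act_of_lt {x y : X} (h : crit y < crit x) : crit (x ◃ y) = crit y := by
  obtain ⟨s, hs, e⟩ := exists_crit_eq y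
  rw [← e] at h ⊢
  suffices crit (x ◃ s) ≤ crit s from
    ((crit_act_mono x e.ge).trans this).antisymm (e.le.trans (crit_le_crit_act x y))
  by_contra! h3
  -- If `x` moved `crit s`, all Fibonacci terms after the first would have larger critical point.
  -- But one of them acts as `x` after `s`, and so kills `s`.
  have key : ∀ n, crit s < crit (fib x s (n + 1)) := by
    intro n
    induction n using Nat.twoStepInduction with
    | zero => exact h
    | one => exact h3
    | more n ih jh => exact lt_crit_act ih
  obtain ⟨n, hn⟩ := IsPermutative.exists_fib_mem x s
  refine (key n).not_ge (crit_le_of_act_mem ?_)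
  rw [fib_succ_act hn]
  exact act_mem_leftIds x hs

/-! ### The congruences `≡^α` -/

/-- Apply `r` to `s * x = s * y`: since `r * s` is a left identity, `r * (s * x) = r * x`. This
gives independence of the representative. -/
theorem equivAt_iff {r : X} (hr : r ◃ r ∈ leftIds X) {x y : X} :
    EquivAt (crit r) x y ↔ r ◃ x = r ◃ y := by
  refine ⟨fun ⟨s, hs, e, h⟩ => ?_, fun h => ⟨r, hr, rfl, h⟩⟩
  have h1 := (crit_le_iff hr).1 e.ge
  have h2 := congrArg (fun z => r ◃ z) h
  simpa only [Shelf.self_distrib (x := r) (y := s), h1 _] using h2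

theorem EquivAt.mono {α β : Crit X} (h : α ≤ β) {x y : X} (hxy : EquivAt β x y) :
    EquivAt α x y := by
  obtain ⟨s, hs, rfl, k⟩ := hxy
  obtain ⟨r, hr, rfl⟩ := exists_rep α
  have h1 := (crit_le_iff hr).1 h
  refine ⟨r, hr, rfl, ?_⟩
  have h2 := congrArg (fun z => r ◃ z) k
  simpa only [Shelf.self_distrib (x := r) (y := s), h1 _] using h2

theorem EquivAt.trans {α : Crit X} {x y z : X} (h : EquivAt α x y) (k : EquivAt α y z) :
    EquivAt α x z := by
  obtain ⟨r, hr, rfl⟩ := exists_rep α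
  rw [equivAt_iff hr] at *
  exact h.trans k

theorem EquivAt.symm {α : Crit X} {x y : X} (h : EquivAt α x y) : EquivAt α y x :=
  h.imp fun _ h => ⟨h.1, h.2.1, h.2.2.symm⟩

theorem EquivAt.act {α : Crit X} {x y x' y' : X} (h : EquivAt α x y) (k : EquivAt α x' y') :
    EquivAt α (x ◃ x') (y ◃ y') := by
  obtain ⟨r, hr, rfl⟩ := exists_rep α
  rw [equivAt_iff hr] at *
  rw [Shelf.self_distrib, Shelf.self_distrib (x := r) (y := y), h, k]

theorem EquivAt.act_left {α : Crit X} {y z : X} (x : X) (h : EquivAt α y z) :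
    EquivAt (sharp x α) (x ◃ y) (x ◃ z) := by
  obtain ⟨r, hr, rfl, h⟩ := h
  refine ⟨x ◃ r, ?_, rfl, ?_⟩
  · rw [← Shelf.self_distrib]; exact act_mem_leftIds x hr
  · rw [← Shelf.self_distrib, h, Shelf.self_distrib]

theorem equivAt_act {α : Crit X} {x : X} (h : α ≤ crit x) (y : X) : EquivAt α (x ◃ y) y := by
  obtain ⟨r, hr, rfl⟩ := exists_rep α
  rw [equivAt_iff hr, Shelf.self_distrib, (crit_le_iff hr).1 h]

theorem EquivAt.le_crit {α : Crit X} {x y : X} (h : EquivAt α x y) (hx : α ≤ crit x) :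
    α ≤ crit y := by
  obtain ⟨r, hr, rfl⟩ := exists_rep α
  rw [equivAt_iff hr] at h
  rw [crit_le_iff hr] at *
  rwa [← h]

theorem EquivAt.crit_eq {α : Crit X} {x y : X} (h : EquivAt α x y) (hx : crit x < α) :
    crit x = crit y := by
  refine ((h.mono hx.le).le_crit le_rfl).antisymm ?_
  by_contra! hlt
  have hmin : crit x < min (crit y) α := lt_min hlt hx
  exact hmin.not_ge ((h.symm.mono (min_le_right _ _)).le_crit (min_le_left _ _))

theorem crit_act_ne (x w : X) (hx : x ∉ leftIds X) : crit (x ◃ w) ≠ crit x := by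
  rcases lt_or_ge (crit w) (crit x) with h | h
  · rw [crit_act_of_lt h]; exact h.ne
  · exact ((crit_lt_crit_act le_rfl hx).trans_le (crit_act_mono x h)).ne'

/-! ### Cycles of left division -/

/-- If a cycle of left division starts at an element of greatest critical point, then this element
is a left identity. -/
theorem not_cycle_of_crit_le (x y : ℕ → X) (hstep : ∀ i, x (i + 1) = x i ◃ y i) (p : ℕ)
    (hp : x (p + 1) = x 0) (hx : ∀ i ≤ p, crit (x i) ≤ crit (x 0)) : x 0 ∈ leftIds X := by
  by_contra h0
  obtain ⟨i0, hi0, hmin⟩ := Finset.exists_min_image (Finset.range (p + 1))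
    (fun i => crit (x i ◃ x 0)) ⟨0, by simp⟩
  set β := crit (x i0 ◃ x 0)
  have hβ : crit (x 0) < β :=
    crit_lt_crit_act (hx i0 (by simpa [Nat.lt_succ_iff] using hi0)) h0
  have key : ∀ i ≤ p, ∃ w, EquivAt β (x (i + 1)) (x 0 ◃ w) := by
    intro i
    induction i with
    | zero =>
      obtain ⟨r, hr, e⟩ := exists_rep β
      exact fun _ => ⟨y 0, r, hr, e, by rw [hstep]⟩
    | succ i ih =>
      intro hi
      obtain ⟨w, hw⟩ := ih (by omega)
      refine ⟨w ◃ y (i + 1), ?_⟩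
      -- Acting by `x₀` is trivial modulo `≡^{crit x₀}`; acting by `x (i + 1)` raises the level to
      -- `crit (x (i + 1) * x₀)`, which is at least `β`.
      have h1 : EquivAt β (x (i + 1) ◃ y (i + 1)) (x (i + 1) ◃ (x 0 ◃ y (i + 1))) :=
        (((equivAt_act (le_refl (crit (x 0))) (y (i + 1))).symm).act_left (x (i + 1))).mono
          (hmin (i + 1) (by simpa using by omega))
      rw [hstep, Shelf.self_distrib (x := x 0)]
      refine h1.trans (hw.act ?_)
      obtain ⟨r, hr, e⟩ := exists_rep β
      exact ⟨r, hr, e, rfl⟩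
  obtain ⟨w, hw⟩ := key p le_rfl
  rw [hp] at hw
  exact crit_act_ne _ w h0 (hw.crit_eq hβ).symm

/-- Every cycle of left division in a permutative LD-system passes through a left identity. -/
theorem exists_mem_leftIds_of_cycle (x y : ℕ → X) (hstep : ∀ i, x (i + 1) = x i ◃ y i) (p : ℕ)
    (hper : ∀ i, x (i + (p + 1)) = x i) : ∃ i, x i ∈ leftIds X := by
  obtain ⟨i0, -, hmax⟩ := Finset.exists_max_image (Finset.range (p + 1))
    (fun i => crit (x i)) ⟨0, by simp⟩
  have hmax' : ∀ i, crit (x i) ≤ crit (x i0) := by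
    intro i
    have : x i = x (i % (p + 1)) := by
      have h : ∀ k j, x (j + (p + 1) * k) = x j := by
        intro k
        induction k with
        | zero => simp
        | succ k ih => intro j; rw [Nat.mul_succ, ← add_assoc, hper, ih]
      conv_lhs => rw [← Nat.mod_add_div i (p + 1)]
      exact h _ _
    rw [this]
    exact hmax _ (Finset.mem_range.2 (Nat.mod_lt _ p.succ_pos))
  refine ⟨i0, not_cycle_of_crit_le (fun i => x (i0 + i)) (fun i => y (i0 + i))
    (fun i => hstep _) p (hper i0) fun i _ => hmax' _⟩

end Permutative

namespace Term

variable {ι : Type v}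

/-! ### Expansions of terms -/

/-- `Exp s t` means that `t` is obtained from `s` by applying the self-distributivity identity in
the expanding direction to subterms. -/
inductive Exp : Term ι → Term ι → Prop
  | refl (a) : Exp a a
  | trans {a b c} : Exp a b → Exp b c → Exp a c
  | act {a b c d} : Exp a b → Exp c d → Exp (.act a c) (.act b d)
  | ld (a b c) : Exp (.act a (.act b c)) (.act (.act a b) (.act a c))

theorem Exp.eqv {s t : Term ι} (h : Exp s t) : Eqv s t := by
  induction h with
  | refl a => exact .refl a
  | trans _ _ ih jh => exact ih.trans jh
  | act _ _ ih jh => exact ih.act jh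
  | ld a b c => exact .ld a b c

/-- The term obtained from `t` by replacing every leaf `x` by `s * x`. -/
def dist (s : Term ι) : Term ι → Term ι
  | var i => act s (var i)
  | act a b => act (dist s a) (dist s b)

/-- Dehornoy's fundamental expansion: a common expansion of all one-step expansions of a term. -/
def fund : Term ι → Term ι
  | var i => var i
  | act a b => dist (fund a) (fund b)

theorem exp_dist (s t : Term ι) : Exp (act s t) (dist s t) := by
  induction t with
  | var i => exact .refl _
  | act a b iha ihb => exact (Exp.ld s a b).trans (iha.act ihb)

theorem Exp.dist_left {s s' : Term ι} (h : Exp s s') (t : Term ι) :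
    Exp (dist s t) (dist s' t) := by
  induction t with
  | var i => exact h.act (.refl _)
  | act a b iha ihb => exact iha.act ihb

theorem Exp.dist_right (s : Term ι) {t t' : Term ι} (h : Exp t t') :
    Exp (dist s t) (dist s t') := by
  induction h with
  | refl a => exact .refl _
  | trans _ _ ih jh => exact ih.trans jh
  | act _ _ ih jh => exact ih.act jh
  | ld a b c => exact .ld _ _ _

theorem exp_dist_dist (a b c : Term ι) :
    Exp (dist a (dist b c)) (dist (dist a b) (dist a c)) := by
  induction c with
  | var i => exact exp_dist (dist a b) (act a (var i))
  | act c d ihc ihd => exact ihc.act ihd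

theorem exp_fund (t : Term ι) : Exp t (fund t) := by
  induction t with
  | var i => exact .refl _
  | act a b iha ihb => exact (iha.act ihb).trans (exp_dist _ _)

theorem Exp.fund {t t' : Term ι} (h : Exp t t') : Exp t.fund t'.fund := by
  induction h with
  | refl a => exact .refl _
  | trans _ _ ih jh => exact ih.trans jh
  | act _ _ ih jh => exact (ih.dist_left _).trans (jh.dist_right _)
  | ld a b c => exact exp_dist_dist _ _ _

theorem Exp.iterate_fund {t t' : Term ι} (h : Exp t t') (n : ℕ) :
    Exp (Term.fund^[n] t) (Term.fund^[n] t') := by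
  induction n with
  | zero => exact h
  | succ n ih => rw [Function.iterate_succ_apply', Function.iterate_succ_apply']; exact ih.fund

theorem exp_iterate_fund (t : Term ι) (n : ℕ) : Exp t (fund^[n] t) := by
  induction n with
  | zero => exact .refl t
  | succ n ih => rw [Function.iterate_succ_apply']; exact ih.trans (exp_fund _)

theorem exp_iterate_fund_of_le (t : Term ι) {m n : ℕ} (h : m ≤ n) :
    Exp (fund^[m] t) (fund^[n] t) := by
  obtain ⟨k, rfl⟩ := Nat.exists_eq_add_of_le' h
  rw [Function.iterate_add_apply]
  exact exp_iterate_fund _ k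

theorem exp_act_iterate_fund (a b : Term ι) (n : ℕ) :
    Exp (act (fund^[n] a) (fund^[n] b)) (fund^[n] (act a b)) := by
  induction n with
  | zero => exact .refl _
  | succ n ih =>
    simp only [Function.iterate_succ_apply']
    exact (exp_dist _ _).trans ih.fund

/-- Iterated fundamental expansions are cofinal among the expansions of a term, which yields
confluence. -/
theorem Exp.exists_iterate_fund {t t' : Term ι} (h : Exp t t') :
    ∃ n, Exp t' (Term.fund^[n] t) := by
  induction h with
  | refl a => exact ⟨0, .refl a⟩
  | trans _ _ ih jh =>
    obtain ⟨n, hn⟩ := ih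
    obtain ⟨m, hm⟩ := jh
    exact ⟨m + n, by rw [Function.iterate_add_apply]; exact hm.trans (hn.iterate_fund m)⟩
  | @act a b c d _ _ ih jh =>
    obtain ⟨n, hn⟩ := ih
    obtain ⟨m, hm⟩ := jh
    exact ⟨max n m, ((hn.trans (exp_iterate_fund_of_le a (le_max_left n m))).act
      (hm.trans (exp_iterate_fund_of_le c (le_max_right n m)))).trans (exp_act_iterate_fund a c _)⟩
  | ld a b c =>
    refine ⟨1, (((exp_fund a).act (exp_fund b)).act ((exp_fund a).act (exp_fund c))).trans ?_⟩
    exact ((exp_dist _ _).act (exp_dist _ _)).trans ((exp_dist b.fund c.fund).dist_right a.fund)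

/-- Equivalent terms have a common expansion. -/
theorem Eqv.exists_exp {s t : Term ι} (h : Eqv s t) : ∃ u, Exp s u ∧ Exp t u := by
  induction h with
  | refl a => exact ⟨a, .refl a, .refl a⟩
  | symm _ ih => exact ih.imp fun _ h => h.symm
  | @trans a b c _ _ ih jh =>
    obtain ⟨u, hau, hbu⟩ := ih
    obtain ⟨w, hbw, hcw⟩ := jh
    obtain ⟨n, hn⟩ := hbu.exists_iterate_fund
    obtain ⟨m, hm⟩ := hbw.exists_iterate_fund
    exact ⟨_, (hau.trans hn).trans (exp_iterate_fund_of_le b (le_max_left n m)),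
      (hcw.trans hm).trans (exp_iterate_fund_of_le b (le_max_right n m))⟩
  | act _ _ ih jh =>
    obtain ⟨u, h1, h2⟩ := ih
    obtain ⟨w, h3, h4⟩ := jh
    exact ⟨_, h1.act h3, h2.act h4⟩
  | ld a b c => exact ⟨_, .ld a b c, .refl _⟩

/-! ### Iterated left subterms and the comparison property -/

/-- `LeftSub s t` means that `s` is an iterated left subterm of `t`. -/
inductive LeftSub : Term ι → Term ι → Prop
  | refl (a) : LeftSub a a
  | step {a b} (c) : LeftSub a b → LeftSub a (.act b c)

theorem LeftSub.exists_foldl {s t : Term ι} (h : LeftSub s t) :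
    ∃ l : List (Term ι), l.foldl act s = t := by
  induction h with
  | refl => exact ⟨[], rfl⟩
  | step c _ ih =>
    obtain ⟨l, rfl⟩ := ih
    exact ⟨l ++ [c], by simp⟩

theorem LeftSub.total {s t u : Term ι} (hs : LeftSub s u) (ht : LeftSub t u) :
    LeftSub s t ∨ LeftSub t s := by
  induction hs with
  | refl => exact .inr ht
  | step c h ih =>
    cases ht with
    | refl => exact .inl (h.step c)
    | step _ k => exact ih k

theorem Exp.exists_leftSub {t t' : Term ι} (h : Exp t t') :
    ∀ {s}, LeftSub s t → ∃ s', Exp s s' ∧ LeftSub s' t' := by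
  induction h with
  | refl a => exact fun hs => ⟨_, .refl _, hs⟩
  | trans _ _ ih jh =>
    intro s hs
    obtain ⟨s', h1, h2⟩ := ih hs
    obtain ⟨s'', h3, h4⟩ := jh h2
    exact ⟨s'', h1.trans h3, h4⟩
  | act h k ih _ =>
    intro s hs
    cases hs with
    | refl => exact ⟨_, h.act k, .refl _⟩
    | step _ hs =>
      obtain ⟨s', h1, h2⟩ := ih hs
      exact ⟨s', h1, h2.step _⟩
  | ld a b c =>
    intro s hs
    cases hs with
    | refl => exact ⟨_, .ld a b c, .refl _⟩
    | step _ hs => exact ⟨s, .refl s, (hs.step b).step _⟩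

/-- The right powers of the variable. -/
def rightPow : ℕ → Term Unit
  | 0 => var ()
  | n + 1 => act (var ()) (rightPow n)

/-- Absorption of large right powers: `(a * b) * x^[n+1]` is equivalent to `(a * b) * (a * x^[n])`,
hence to `a * (b * x^[n])`, and both factors absorb. -/
theorem exists_act_rightPow_eqv (t : Term Unit) :
    ∃ N, ∀ n, N ≤ n → Eqv (act t (rightPow n)) (rightPow (n + 1)) := by
  induction t with
  | var i => exact ⟨0, fun n _ => .refl _⟩
  | act a b iha ihb =>
    obtain ⟨N, hN⟩ := iha
    obtain ⟨M, hM⟩ := ihb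
    refine ⟨N + M + 1, fun n hn => ?_⟩
    obtain ⟨n, rfl⟩ : ∃ p, n = p + 1 := ⟨n - 1, by omega⟩
    exact (((Eqv.refl (act a b)).act (hN n (by omega)).symm).trans (Eqv.ld a b _).symm).trans
      (((Eqv.refl a).act (hM n (by omega))).trans (hN (n + 1) (by omega)))

/-- The comparison property: of two terms in one variable, one is equivalent to an iterated left
subterm of a term equivalent to the other. -/
theorem exists_leftSub_or (s t : Term Unit) :
    ∃ s' t', Eqv s s' ∧ Eqv t t' ∧ (LeftSub s' t' ∨ LeftSub t' s') := by
  obtain ⟨N, hN⟩ := exists_act_rightPow_eqv s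
  obtain ⟨M, hM⟩ := exists_act_rightPow_eqv t
  -- Both `s` and `t` absorb the same right power, so the two products have a common expansion.
  -- Expansions of `s` and `t` are left subterms of it, hence comparable.
  obtain ⟨u, hsu, htu⟩ :=
    ((hN (max N M) (le_max_left _ _)).trans (hM (max N M) (le_max_right _ _)).symm).exists_exp
  obtain ⟨s', h1, h2⟩ := hsu.exists_leftSub ((LeftSub.refl s).step _)
  obtain ⟨t', h3, h4⟩ := htu.exists_leftSub ((LeftSub.refl t).step _)
  exact ⟨s', t', h1.eqv, h3.eqv, h2.total h4⟩

theorem eval_foldl {X : Type u} [Shelf X] (g : ι → X) (s : Term ι) (l : List (Term ι)) :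
    (l.foldl act s).eval g = (l.map (eval g)).foldl (fun a b => a ◃ b) (s.eval g) := by
  induction l generalizing s with
  | nil => rfl
  | cons a l ih => exact ih _

end Term

/-- Every element of an acyclic LD-system freely generates a sub-LD-system. -/
theorem IsAcyclic.freelyGenerates {X : Type u} [Shelf X] (h : IsAcyclic X) (x : X) :
    FreelyGenerates (fun _ : Unit => x) := by
  have key : ∀ s t : Term Unit, Term.LeftSub s t →
      s.eval (fun _ => x) = t.eval (fun _ => x) → s = t := by
    intro s t hst e
    obtain ⟨l, rfl⟩ := hst.exists_foldl
    rw [Term.eval_foldl] at e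
    by_contra hne
    refine h _ _ (fun hl => hne ?_) e.symm
    rw [List.map_eq_nil_iff] at hl
    rw [hl]; rfl
  rintro ⟨s⟩ ⟨t⟩ (e : s.eval _ = t.eval _)
  obtain ⟨s', t', hs, ht, hst⟩ := Term.exists_leftSub_or s t
  rw [hs.eval_eq, ht.eval_eq] at e
  have : s' = t' := hst.elim (fun k => key _ _ k e) fun k => (key _ _ k e.symm).symm
  exact Quotient.sound (hs.trans (this ▸ ht.symm))

theorem Free.lift_comp {ι : Type v} {X Y : Type u} [Shelf X] [Shelf Y] (f : X →◃ Y) (g : ι → X)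
    (a : Free ι) : Free.lift (f ∘ g) a = f (Free.lift g a) :=
  (DFunLike.congr_fun (Free.eq_lift (f ∘ g) (f.comp (Free.lift g)) fun _ => rfl) a).symm

theorem FreelyGenerates.of_comp {ι : Type v} {X Y : Type u} [Shelf X] [Shelf Y] (f : X →◃ Y)
    {g : ι → X} (h : FreelyGenerates (f ∘ g)) : FreelyGenerates g := fun a b e =>
  h (by rw [Free.lift_comp, Free.lift_comp, e])

theorem FreelyGenerates.comp {ι : Type v} {X Y : Type u} [Shelf X] [Shelf Y] (f : X →◃ Y)
    (hf : Function.Injective f) {g : ι → X} (h : FreelyGenerates g) :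
    FreelyGenerates (f ∘ g) := fun a b e =>
  h (hf (by rwa [Free.lift_comp, Free.lift_comp] at e))

/-- The inclusion of a sub-LD-system. -/
def SubLDSystem.subtype {X : Type u} [Shelf X] (S : SubLDSystem X) : S.carrier →◃ X where
  toFun := Subtype.val
  map_act' := rfl

/-! ### Free LD-monoids on one generator -/

section Monoid

variable {ι : Type v}

/-- The canonical homomorphism from the free LD-system to the free LD-monoid. -/
def Free.toMon (ι : Type v) : Free ι →◃ FreeMon ι := Free.lift FreeMon.of

/-- The product `a₁ ∘ ... ∘ aₖ` for a term `a₁ * (a₂ * (... * (aₖ * x)))`. -/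
def Term.rightProd : Term ι → FreeMon ι
  | var _ => 1
  | act a b => a.eval FreeMon.of * b.rightProd

/-- Invariance under self-distributivity is the identity `a ∘ b = (a * b) ∘ a`. -/
theorem Term.Eqv.rightProd_eq {s t : Term ι} (h : Term.Eqv s t) : s.rightProd = t.rightProd := by
  induction h with
  | refl => rfl
  | symm _ ih => exact ih.symm
  | trans _ _ ih jh => exact ih.trans jh
  | act h _ _ jh => simp only [Term.rightProd]; rw [h.eval_eq, jh]
  | ld a b c =>
    simp only [Term.rightProd, Term.eval]
    rw [← mul_assoc (a.eval _), ← mul_assoc (a.eval _ ◃ b.eval _),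
      LDMonoid.mul_eq_act_mul (a.eval _)]

/-- The map `a₁ * (a₂ * (... * (aₖ * x))) ↦ a₁ ∘ ... ∘ aₖ` on the free LD-system. -/
def Free.rightProd : Free ι → FreeMon ι :=
  Quotient.lift Term.rightProd fun _ _ h => h.rightProd_eq

theorem Free.rightProd_act (a b : Free ι) :
    Free.rightProd (a ◃ b) = Free.toMon ι a * Free.rightProd b := by
  rcases a with ⟨a⟩; rcases b with ⟨b⟩; rfl

theorem Free.rightProd_foldr (i : ι) (l : List (Free ι)) :
    Free.rightProd (l.foldr (fun a b => a ◃ b) (Free.of i)) = (l.map (Free.toMon ι)).prod := by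
  induction l with
  | nil => rfl
  | cons a l ih => rw [List.foldr_cons, Free.rightProd_act, ih, List.map_cons, List.prod_cons]

theorem map_foldr_act {X : Type u} {Y : Type v} [Shelf X] [Shelf Y] [LDMonoid Y] (f : X →◃ Y)
    (l : List X) (x : X) :
    f (l.foldr (fun a b => a ◃ b) x) = (l.map f).prod ◃ f x := by
  induction l with
  | nil => exact (LDMonoid.one_act _).symm
  | cons a l ih =>
    rw [List.foldr_cons, ShelfHom.map_act, ih, List.map_cons, List.prod_cons, LDMonoid.mul_act]

/-- Every element of the free LD-monoid is a product of elements of the free LD-system. -/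
theorem FreeMon.exists_eq_prod (a : FreeMon ι) :
    ∃ l : List (Free ι), a = (l.map (Free.toMon ι)).prod := by
  obtain ⟨t, rfl⟩ := Quotient.exists_rep a
  induction t with
  | var i => exact ⟨[Free.of i], (mul_one (FreeMon.of i)).symm⟩
  | one => exact ⟨[], rfl⟩
  | mul s t ihs iht =>
    obtain ⟨l, hl⟩ := ihs
    obtain ⟨m, hm⟩ := iht
    refine ⟨l ++ m, ?_⟩
    rw [List.map_append, List.prod_append, ← hl, ← hm]; rfl
  | act s t ihs iht =>
    obtain ⟨l, hl⟩ := ihs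
    obtain ⟨m, hm⟩ := iht
    refine ⟨m.map fun b => l.foldr (fun a b => a ◃ b) b, ?_⟩
    have h : ∀ m : List (Free ι), (l.map (Free.toMon ι)).prod ◃ (m.map (Free.toMon ι)).prod =
        ((m.map fun b => l.foldr (fun a b => a ◃ b) b).map (Free.toMon ι)).prod := by
      intro m
      induction m with
      | nil => exact LDMonoid.act_one _
      | cons b m ih =>
        rw [List.map_cons, List.prod_cons, LDMonoid.act_mul, ih, List.map_cons, List.map_cons,
          List.prod_cons, map_foldr_act]
    rw [← h, ← hl, ← hm]; rfl

theorem FreeMon.lift_toMon {X : Type u} [Shelf X] [LDMonoid X] (g : ι → X) (a : Free ι) :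
    FreeMon.lift g (Free.toMon ι a) = Free.lift g a :=
  DFunLike.congr_fun
    (Free.eq_lift g ((FreeMon.lift g).comp (Free.toMon ι)) fun _ => rfl) a

/-- An element of an LD-monoid that freely generates a sub-LD-system freely generates a
sub-LD-monoid. -/
theorem FreelyGenerates.freelyGeneratesMon {X : Type u} [Shelf X] [LDMonoid X] {g : Unit → X}
    (h : FreelyGenerates g) : FreelyGeneratesMon g := by
  intro a b e
  obtain ⟨l, rfl⟩ := a.exists_eq_prod
  obtain ⟨m, rfl⟩ := b.exists_eq_prod
  -- Both products are read off from elements of the free LD-system, which coincide because their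
  -- values, the products acting on the generator, do.
  rw [← Free.rightProd_foldr (), ← Free.rightProd_foldr ()]
  congr 1
  apply h
  rw [← FreeMon.lift_toMon, ← FreeMon.lift_toMon, map_foldr_act, map_foldr_act,
    ShelfHom.map_act, ShelfHom.map_act, e]

end Monoid

/-! ### Composition and homomorphisms. -/

section Permutative

variable {X : Type u} [Shelf X]

theorem map_pw {Y : Type v} [Shelf Y] (f : X →◃ Y) (x y : X) (n : ℕ) :
    f (pw x n y) = pw (f x) n (f y) := by
  induction n with
  | zero => rfl
  | succ n ih => simp only [pw]; rw [ShelfHom.map_act, ih]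

theorem map_fib {Y : Type v} [Shelf Y] (f : X →◃ Y) (x y : X) (n : ℕ) :
    f (fib x y n) = fib (f x) (f y) n := by
  induction n using Nat.twoStepInduction with
  | zero => rfl
  | one => rfl
  | more n ih jh => simp only [fib]; rw [ShelfHom.map_act, ih, jh]

theorem map_mem_leftIds {Y : Type v} [Shelf Y] (f : X →◃ Y) (hf : Function.Surjective f) {x : X}
    (hx : x ∈ leftIds X) : f x ∈ leftIds Y := by
  intro y
  obtain ⟨y, rfl⟩ := hf y
  rw [← ShelfHom.map_act, hx]

variable [IsPermutative X]

theorem belowMax_crit {x : X} : BelowMax (crit x) ↔ x ∉ leftIds X := by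
  obtain ⟨e, he⟩ := exists_leftId x
  constructor
  · rintro ⟨μ, -, h⟩ hx
    obtain ⟨m, rfl⟩ := Quotient.exists_rep μ
    exact h.not_ge (crit_le_of_mem m hx)
  · intro hx
    refine ⟨crit e, fun α => ?_, lt_of_not_ge fun h => hx (mem_of_crit_le he h)⟩
    obtain ⟨y, rfl⟩ := Quotient.exists_rep α
    exact crit_le_of_mem y he

theorem isTop_crit {x : X} : IsTop (crit x) ↔ x ∈ leftIds X := by
  constructor
  · intro h
    obtain ⟨e, he⟩ := exists_leftId x
    exact mem_of_crit_le he (h _)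
  · intro hx α
    obtain ⟨y, rfl⟩ := Quotient.exists_rep α
    exact crit_le_of_mem y hx

theorem comp_act (x y z : X) : comp x y ◃ z = x ◃ (y ◃ z) := by
  classical
  exact fib_succ_act (Nat.find_spec (IsPermutative.exists_fib_mem x y)) z

/-- Otherwise `x = (x ∘ y) * x = x * (y * x)`, whose critical point is at least `crit (x * x) > crit
x`. -/
theorem comp_notMem_leftIds {x : X} (y : X) (hx : x ∉ leftIds X) : comp x y ∉ leftIds X := by
  intro h
  refine (crit_lt_crit_act le_rfl hx).not_ge ?_
  conv_rhs => rw [← h x, comp_act]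
  exact crit_act_mono x (crit_le_crit_act y x)

theorem fib_add_succ_eq (h : IsReduced X) (x y : X) (k n : ℕ) (hn : fib x y n ∈ leftIds X)
    (hk : fib x y (n + k) ∈ leftIds X) : fib x y (n + k + 1) = fib x y (n + 1) := by
  have step : ∀ n, fib x y n ∈ leftIds X → fib x y (n + 2) ∈ leftIds X := fun n hn =>
    act_mem_leftIds _ hn
  induction k using Nat.twoStepInduction generalizing n with
  | zero => rfl
  | one => exact h.unique (step n hn) hk
  | more k ih _ =>
    have h3 : fib x y (n + 2 + 1) = fib x y (n + 1) := step n hn _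
    rw [show n + (k + 2) = n + 2 + k by omega] at hk ⊢
    rw [ih (n + 2) (step n hn) hk, h3]

/-- In a reduced permutative LD-system, composition is computed by any Fibonacci term that is the
left identity. -/
theorem comp_eq (h : IsReduced X) {x y : X} {n : ℕ} (hn : fib x y n ∈ leftIds X) :
    comp x y = fib x y (n + 1) := by
  classical
  obtain ⟨k, rfl⟩ := Nat.exists_eq_add_of_le
    (Nat.find_min' (IsPermutative.exists_fib_mem x y) hn)
  rw [fib_add_succ_eq h _ _ _ _ (Nat.find_spec (IsPermutative.exists_fib_mem x y)) hn]
  unfold comp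
  congr!

theorem map_comp {Y : Type v} [Shelf Y] [IsPermutative Y] (hX : IsReduced X) (hY : IsReduced Y)
    (f : X →◃ Y) (hf : Function.Surjective f) (x y : X) : f (comp x y) = comp (f x) (f y) := by
  obtain ⟨n, hn⟩ := IsPermutative.exists_fib_mem x y
  have h := map_mem_leftIds f hf hn
  rw [map_fib] at h
  rw [comp_eq hX hn, comp_eq hY h, map_fib]

end Permutative

/-! ### Threads and their extension to all levels. -/

section Inverse

variable {X : ℕ → Type u} [∀ n, Shelf (X n)] {φ : ∀ n, X (n + 1) →◃ X n}

theorem exists_map_eq_trans (n k : ℕ) (z : X (n + (k + 1))) :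
    ∃ w, φ n w = trans φ n (k + 1) z := by
  induction k with
  | zero => exact ⟨z, rfl⟩
  | succ k ih => exact ih (φ (n + (k + 1)) z)

theorem trans_coord (z : InvLim φ) (n k : ℕ) : trans φ n k (z.1 (n + k)) = z.1 n := by
  induction k with
  | zero => rfl
  | succ k ih =>
    rw [← ih, ← z.2 (n + k)]; rfl

theorem coord_eq_of_le {z w : InvLim φ} {m n : ℕ} (h : m ≤ n) (e : z.1 n = w.1 n) :
    z.1 m = w.1 m := by
  obtain ⟨k, rfl⟩ := Nat.exists_eq_add_of_le h
  rw [← trans_coord z m k, ← trans_coord w m k, e]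

theorem exists_thread (hs : ∀ n, Function.Surjective (φ n)) (n : ℕ) (x : X n) :
    ∃ z : InvLim φ, z.1 n = x := by
  classical
  choose g hg using hs
  obtain ⟨f, hf, hfn⟩ : ∃ f : ∀ i, X i, f n = x ∧ ∀ i < n, φ i (f (i + 1)) = f i := by
    induction n with
    | zero => exact ⟨fun i => Nat.rec x g i, rfl, fun i hi => absurd hi (by omega)⟩
    | succ n ih =>
      obtain ⟨f, hf, hfn⟩ := ih (φ n x)
      refine ⟨Function.update f (n + 1) x, by simp, fun i hi => ?_⟩
      rw [Function.update_of_ne (by omega : i ≠ n + 1)]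
      rcases (Nat.lt_succ_iff.1 hi).eq_or_lt with rfl | hi
      · rw [Function.update_self, hf]
      · rw [Function.update_of_ne (by omega), hfn i hi]
  -- Lifts are chosen to follow `f` as long as this is compatible, that is, up to level `n`.
  have hstep : ∀ i (y : X i), ∃ w, φ i w = y ∧ (φ i (f (i + 1)) = y → w = f (i + 1)) := by
    intro i y
    by_cases h : φ i (f (i + 1)) = y
    · exact ⟨_, h, fun _ => rfl⟩
    · exact ⟨g i y, hg i y, fun k => absurd k h⟩
  choose s hs hsf using hstep
  let F : ∀ i, X i := fun i => Nat.rec (f 0) s i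
  refine ⟨⟨F, fun i => hs i (F i)⟩, ?_⟩
  have h : ∀ i ≤ n, F i = f i := by
    intro i
    induction i with
    | zero => exact fun _ => rfl
    | succ i ih => exact fun hi => hsf i (F i) (by rw [ih (by omega), hfn i hi])
  exact (h n le_rfl).trans hf

/-! ### The topology of the inverse limit -/

theorem isOpen_iff {U : Set (InvLim φ)} :
    IsOpen U ↔ ∀ x ∈ U, ∃ n, ∀ z : InvLim φ, z.1 n = x.1 n → z ∈ U := by
  let : ∀ n, TopologicalSpace (X n) := fun _ => ⊥
  have : ∀ n, DiscreteTopology (X n) := fun _ => ⟨rfl⟩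
  have hcont : Continuous fun x : InvLim φ => x.1 := continuous_induced_dom
  constructor
  · intro hU x hx
    obtain ⟨V, hV, rfl⟩ := isOpen_induced_iff.1 hU
    obtain ⟨I, u, hu, hI⟩ := isOpen_pi_iff.1 hV x.1 hx
    refine ⟨I.sup id, fun z hz => hI fun i hi => ?_⟩
    have e : z.1 i = x.1 i := coord_eq_of_le (Finset.le_sup (f := id) hi) hz
    change z.1 i ∈ u i
    rw [e]
    exact (hu i hi).2
  · intro h
    refine isOpen_iff_forall_mem_open.2 fun x hx => ?_
    obtain ⟨n, hn⟩ := h x hx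
    exact ⟨{z | z.1 n = x.1 n}, hn,
      (isOpen_discrete {x.1 n}).preimage ((continuous_apply n).comp hcont), rfl⟩

theorem dense_iff {U : Set (InvLim φ)} :
    Dense U ↔ ∀ (x : InvLim φ) (n : ℕ), ∃ z ∈ U, z.1 n = x.1 n := by
  rw [dense_iff_inter_open]
  constructor
  · intro h x n
    obtain ⟨z, hz, hzU⟩ := h {z | z.1 n = x.1 n} (isOpen_iff.2 fun y hy => ⟨n, fun z hz =>
      hz.trans hy⟩) ⟨x, rfl⟩
    exact ⟨z, hzU, hz⟩
  · rintro h V hV ⟨x, hx⟩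
    obtain ⟨n, hn⟩ := isOpen_iff.1 hV x hx
    obtain ⟨z, hz, e⟩ := h x n
    exact ⟨z, hn z e, hz⟩

instance : BaireSpace (InvLim φ) := by
  let : ∀ n, TopologicalSpace (X n) := fun _ => ⊥
  have : ∀ n, DiscreteTopology (X n) := fun _ => ⟨rfl⟩
  have hclosed : IsClosed {x : ∀ n, X n | ∀ n, φ n (x (n + 1)) = x n} := by
    rw [Set.ofPred_forall]
    exact isClosed_iInter fun n => isClosed_eq
      (continuous_of_discreteTopology.comp (continuous_apply (n + 1))) (continuous_apply n)
  have : TopologicalSpace.IsCompletelyMetrizableSpace (InvLim φ) :=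
    hclosed.isCompletelyMetrizableSpace
  infer_instance

/-! ### Nontrivial threads -/

/-- A thread is nontrivial if some coordinate is not a left identity. -/
def Nontriv (x : InvLim φ) : Prop := ∃ n, x.1 n ∉ leftIds (X n)

theorem act_coord (x y : InvLim φ) (n : ℕ) : (x ◃ y).1 n = x.1 n ◃ y.1 n := rfl

theorem isOpen_exists_nontriv_act (n : ℕ) :
    IsOpen {x : InvLim φ | ∃ y : InvLim φ, y.1 n ∈ leftIds (X n) ∧ Nontriv (x ◃ y)} :=
  isOpen_iff.2 fun _ ⟨y, hy, m, hm⟩ => ⟨m, fun z hz => ⟨y, hy, m, by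
    rw [act_coord, hz]; exact hm⟩⟩

theorem isOpen_nontriv : IsOpen {x : InvLim φ | Nontriv x} :=
  isOpen_iff.2 fun _ ⟨n, hn⟩ => ⟨n, fun _ hz => ⟨n, hz ▸ hn⟩⟩

theorem mem_leftIds_of_le (hs : ∀ n, Function.Surjective (φ n)) {x : InvLim φ} {m n : ℕ}
    (h : m ≤ n) (hx : x.1 n ∈ leftIds (X n)) : x.1 m ∈ leftIds (X m) := by
  induction n, h using Nat.le_induction with
  | base => exact hx
  | succ n _ ih => exact ih (x.2 n ▸ map_mem_leftIds (φ n) (hs n) hx)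

/-! ### Critical points along a vast inverse system. -/

variable [∀ n, IsPermutative (X n)]

theorem IsVast.surjective (hφ : IsVast φ) (n : ℕ) : Function.Surjective (φ n) := by
  intro x
  obtain ⟨e, he⟩ := exists_leftId x
  -- Pairing `x` with a left identity forces the lift to occur at a strictly higher level.
  obtain ⟨k, x', y', hx, hy, h⟩ := hφ.exists_lift n x e
  cases k with
  | zero =>
    refine absurd (act_mem_leftIds x' ?_) h
    rwa [show y' = e from hy]
  | succ k => exact hx ▸ exists_map_eq_trans n k x'

theorem IsVast.exists_act_notMem (hφ : IsVast φ) (n : ℕ) (x y : InvLim φ) :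
    ∃ x' y' : InvLim φ, x'.1 n = x.1 n ∧ y'.1 n = y.1 n ∧ Nontriv (x' ◃ y') := by
  obtain ⟨k, a, b, ha, hb, h⟩ := hφ.exists_lift n (x.1 n) (y.1 n)
  obtain ⟨x', rfl⟩ := exists_thread hφ.surjective (n + k) a
  obtain ⟨y', rfl⟩ := exists_thread hφ.surjective (n + k) b
  rw [trans_coord] at ha hb
  exact ⟨x', y', ha, hb, n + k, h⟩

theorem Nontriv.of_act {x y : InvLim φ} (h : Nontriv (x ◃ y)) : Nontriv y :=
  h.imp fun _ h k => h (act_mem_leftIds _ k)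

/-- If `φ n x` is a left identity, then `r * (x ^ k * x) = r * x` for a representative `r` of `α`;
some `x ^ k * x` is a left identity, so `r` kills `x`. -/
theorem KerEq.map_mem_leftIds_iff {n : ℕ} {α : Crit (X (n + 1))} (h : KerEq φ n α)
    (hs : Function.Surjective (φ n)) (x : X (n + 1)) :
    φ n x ∈ leftIds (X n) ↔ α ≤ crit x := by
  constructor
  · intro hx
    obtain ⟨r, hr, rfl⟩ := exists_rep α
    have h1 : ∀ y, r ◃ (x ◃ y) = r ◃ y := fun y =>
      (equivAt_iff hr).1 ((h _ _).1 (by rw [ShelfHom.map_act, hx]))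
    have h2 : ∀ k, r ◃ pw x k x = r ◃ x := by
      intro k
      induction k with
      | zero => rfl
      | succ k ih => rw [pw, h1, ih]
    obtain ⟨k, hk⟩ := critLE_refl x
    rw [crit_le_iff hr, ← h2 k]
    exact act_mem_leftIds r hk
  · intro hx y
    obtain ⟨y, rfl⟩ := hs y
    rw [← ShelfHom.map_act]
    exact (h _ _).2 (equivAt_act hx y)

theorem crit_map_mono {n : ℕ} (hs : Function.Surjective (φ n)) {x y : X (n + 1)}
    (h : crit x ≤ crit y) : crit (φ n x) ≤ crit (φ n y) := by
  obtain ⟨k, hk⟩ := h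
  exact ⟨k, map_pw (φ n) x y k ▸ map_mem_leftIds (φ n) hs hk⟩

theorem IsVast.crit_le_of_map (hφ : IsVast φ) {n : ℕ} {x y : X (n + 1)}
    (hx : φ n x ∉ leftIds (X n)) (h : crit (φ n x) ≤ crit (φ n y)) : crit x ≤ crit y := by
  obtain ⟨α, hα⟩ := hφ.exists_kerEq n
  rw [hα.map_mem_leftIds_iff (hφ.surjective n), not_le] at hx
  obtain ⟨k, hk⟩ := h
  rw [← map_pw, hα.map_mem_leftIds_iff (hφ.surjective n)] at hk
  obtain ⟨j, hj⟩ := hx.le.trans hk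
  exact ⟨j + k, by rwa [pw_add]⟩

theorem IsVast.crit_le_of_le (hφ : IsVast φ) {r s : InvLim φ} {m n : ℕ} (hmn : m ≤ n)
    (hr : r.1 m ∉ leftIds (X m)) (h : crit (r.1 m) ≤ crit (s.1 m)) :
    crit (r.1 n) ≤ crit (s.1 n) := by
  induction n, hmn using Nat.le_induction with
  | base => exact h
  | succ n hn ih =>
    refine hφ.crit_le_of_map ?_ (by rwa [r.2, s.2])
    rw [r.2]
    exact fun k => hr (mem_leftIds_of_le hφ.surjective hn k)

theorem IsVast.nontriv_act_mono (hφ : IsVast φ) {x r s : InvLim φ} {m : ℕ}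
    (h : ∀ n, m ≤ n → crit (r.1 n) ≤ crit (s.1 n)) (hs : Nontriv (x ◃ s)) : Nontriv (x ◃ r) := by
  obtain ⟨k, hk⟩ := hs
  have hk' : (x ◃ s).1 (max m k) ∉ leftIds _ := fun h =>
    hk (mem_leftIds_of_le hφ.surjective (le_max_right m k) h)
  exact ⟨max m k, fun hr => hk' (mem_of_crit_le hr (crit_act_mono _ (h _ (le_max_left m k))))⟩

theorem IsVast.nontriv_act_of_mem (hφ : IsVast φ) {x r s : InvLim φ} {m : ℕ}
    (hr : r.1 m ∉ leftIds (X m)) (hsm : s.1 m ∈ leftIds (X m)) (hs : Nontriv (x ◃ s)) :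
    Nontriv (x ◃ r) :=
  hφ.nontriv_act_mono (fun _ hn => hφ.crit_le_of_le hn hr (crit_le_of_mem _ hsm)) hs

theorem IsVast.critLim_mk_eq (hφ : IsVast φ) {r : InvLim φ} {m n : ℕ} (hmn : m ≤ n)
    (hr : r.1 m ∉ leftIds (X m)) :
    Quot.mk (CritStep φ) ⟨n, crit (r.1 n)⟩ = Quot.mk (CritStep φ) ⟨m, crit (r.1 m)⟩ := by
  induction n, hmn using Nat.le_induction with
  | base => rfl
  | succ n hn ih =>
    rw [← ih]
    have h := CritStep.of_notMem (φ := φ) n (r.1 (n + 1))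
    rw [r.2] at h
    exact (Quot.sound (h fun k => hr (mem_leftIds_of_le hφ.surjective hn k))).symm

/-- Every critical point of the system is represented by a critical point that is not greatest. -/
theorem IsVast.exists_critLim_mk_eq (hφ : IsVast φ) (α : CritLim φ) :
    ∃ (n : ℕ) (r : InvLim φ), r.1 n ∉ leftIds (X n) ∧
      Quot.mk (CritStep φ) ⟨n, crit (r.1 n)⟩ = α := by
  obtain ⟨⟨n, β⟩, rfl⟩ := Quot.exists_rep α
  obtain ⟨b, rfl⟩ := Quotient.exists_rep β
  obtain ⟨t, rfl⟩ := exists_thread hφ.surjective n b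
  change ∃ (m : ℕ) (r : InvLim φ), r.1 m ∉ leftIds (X m) ∧
      Quot.mk (CritStep φ) ⟨m, crit (r.1 m)⟩ = Quot.mk (CritStep φ) ⟨n, crit (t.1 n)⟩
  by_contra! hcon
  obtain ⟨t', s, -, hst, hs⟩ := hφ.exists_act_notMem n t t
  -- If every representative of the class is greatest at its level, then so is each `α` defining the
  -- next kernel, and `s` stays trivial at all levels, contrary to its choice.
  have key : ∀ m, n ≤ m → s.1 m ∈ leftIds (X m) ∧ Quot.mk (CritStep φ) ⟨m, crit (s.1 m)⟩ =
      Quot.mk (CritStep φ) ⟨n, crit (t.1 n)⟩ := by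
    intro m hm
    induction m, hm using Nat.le_induction with
    | base =>
      have e : Quot.mk (CritStep φ) ⟨n, crit (s.1 n)⟩ =
        Quot.mk (CritStep φ) ⟨n, crit (t.1 n)⟩ := by rw [hst]
      exact ⟨by_contra fun h => hcon n s h e, e⟩
    | succ m hm ih =>
      obtain ⟨α, hα⟩ := hφ.exists_kerEq m
      obtain ⟨a, rfl⟩ := Quotient.exists_rep α
      obtain ⟨a, rfl⟩ := exists_thread hφ.surjective (m + 1) a
      have e := (Quot.sound (CritStep.of_isTop m _ _ (isTop_crit.2 ih.1) hα)).symm.trans ih.2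
      have ha : a.1 (m + 1) ∈ leftIds (X (m + 1)) := by_contra fun h => hcon _ _ h e
      have hs1 : s.1 (m + 1) ∈ leftIds (X (m + 1)) :=
        mem_of_crit_le ha ((hα.map_mem_leftIds_iff (hφ.surjective m) _).1 (by rw [s.2]; exact ih.1))
      refine ⟨hs1, Eq.trans ?_ e⟩
      congr 2
      exact (crit_le_of_mem _ ha).antisymm (crit_le_of_mem _ hs1)
  obtain ⟨m, hm⟩ := hs.of_act
  exact hm (mem_leftIds_of_le hφ.surjective (le_max_right n m) (key _ (le_max_left n m)).1)

/-- The critical point of the thread `r` is at most the given critical point of the system. -/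
def critLELim (r : InvLim φ) (a : Σ n, Crit (X n)) : Prop :=
  ∀ s : InvLim φ, crit (s.1 a.1) = a.2 → ∃ m, ∀ n, m ≤ n → crit (r.1 n) ≤ crit (s.1 n)

/-- Invariance under the generating identifications lets the comparison with `r` descend to
`CritLim`. -/
theorem IsVast.critLELim_congr (hφ : IsVast φ) (r : InvLim φ) {a b : Σ n, Crit (X n)}
    (h : CritStep φ a b) : critLELim r a ↔ critLELim r b := by
  cases h with
  | of_notMem n x hx =>
    refine forall_congr' fun s => imp_congr_left ⟨fun (h : crit (s.1 n) = crit (φ n x)) => ?_,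
      fun (h : crit (s.1 (n + 1)) = crit x) => ?_⟩
    · rw [← s.2 n] at h
      have hs : φ n (s.1 (n + 1)) ∉ leftIds (X n) := fun k => hx (mem_of_crit_le k h.le)
      exact (hφ.crit_le_of_map hs h.le).antisymm (hφ.crit_le_of_map hx h.ge)
    · change crit (s.1 n) = crit (φ n x)
      rw [← s.2 n]
      exact (crit_map_mono (hφ.surjective n) h.le).antisymm
        (crit_map_mono (hφ.surjective n) h.ge)
  | of_isTop n μ α hμ hα =>
    constructor
    · intro h s hs
      refine h s ?_
      change crit (s.1 n) = μ
      change crit (s.1 (n + 1)) = α at hs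
      have h1 := (hα.map_mem_leftIds_iff (hφ.surjective n) _).2 hs.ge
      rw [s.2] at h1
      exact (hμ _).antisymm (isTop_crit.2 h1 _)
    · intro h s hs
      change crit (s.1 n) = μ at hs
      have hsn : s.1 n ∈ leftIds (X n) := isTop_crit.1 (hs ▸ hμ)
      have h1 := (hα.map_mem_leftIds_iff (hφ.surjective n) (s.1 (n + 1))).1 (by rwa [s.2])
      obtain ⟨a, rfl⟩ := Quotient.exists_rep α
      obtain ⟨a, rfl⟩ := exists_thread hφ.surjective (n + 1) a
      by_cases ha : a.1 (n + 1) ∈ leftIds (X (n + 1))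
      · exact h s ((crit_le_of_mem _ ha).antisymm h1)
      · obtain ⟨m, hm⟩ := h a rfl
        exact ⟨max m (n + 1), fun k hk => (hm k (le_of_max_le_left hk)).trans
          (hφ.crit_le_of_le (le_of_max_le_right hk) ha h1)⟩

/-! ### `EE` and `EE⁺`: closure, category and density. -/

/-- A thread belongs to `EE` if and only if it acts on nontrivial threads. -/
theorem IsVast.mem_EE_iff (hφ : IsVast φ) {x : InvLim φ} :
    x ∈ EE φ ↔ ∀ r, Nontriv r → Nontriv (x ◃ r) := by
  constructor
  · rintro hx r ⟨n, hn⟩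
    obtain ⟨m, β, e, hb⟩ := hx (Quot.mk _ ⟨n, crit (r.1 n)⟩)
    have h1 : critLELim r ⟨n, crit (r.1 n)⟩ := fun s hs =>
      ⟨n, fun k hk => hφ.crit_le_of_le hk hn hs.ge⟩
    have h2 : critLELim r ⟨m, β⟩ :=
      (congrArg (Quot.lift (critLELim r) fun a b h => propext (hφ.critLELim_congr r h)) e).mpr h1
    obtain ⟨b, rfl⟩ := Quotient.exists_rep β
    obtain ⟨s, rfl⟩ := exists_thread hφ.surjective m b
    obtain ⟨k, hk⟩ := h2 s rfl
    exact hφ.nontriv_act_mono hk ⟨m, belowMax_crit.1 hb⟩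
  · intro h α
    obtain ⟨n, r, hr, rfl⟩ := hφ.exists_critLim_mk_eq α
    obtain ⟨m, hm⟩ := h r ⟨n, hr⟩
    refine ⟨max n m, crit (r.1 _), hφ.critLim_mk_eq (le_max_left n m) hr, belowMax_crit.2 fun k =>
      hm (mem_leftIds_of_le hφ.surjective (x := x ◃ r) (le_max_right n m) k)⟩

theorem IsVast.act_mem_EE (hφ : IsVast φ) {x y : InvLim φ} (hx : x ∈ EE φ) (hy : y ∈ EE φ) :
    x ◃ y ∈ EE φ := by
  rw [hφ.mem_EE_iff] at *
  intro r hr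
  have h := hx _ (hy r hr)
  rw [Shelf.self_distrib] at h
  exact hφ.nontriv_act_mono (m := 0) (fun n _ => crit_le_crit_act _ _) h

theorem IsVast.act_mem_EEPlus (hφ : IsVast φ) {x y : InvLim φ} (hx : x ∈ EEPlus φ)
    (hy : y ∈ EEPlus φ) : x ◃ y ∈ EEPlus φ :=
  ⟨hφ.act_mem_EE hx.1 hy.1, hφ.mem_EE_iff.1 hx.1 y hy.2⟩

theorem IsVast.EE_eq (hφ : IsVast φ) : EE φ =
    ⋂ n, {x : InvLim φ | ∃ y : InvLim φ, y.1 n ∈ leftIds (X n) ∧ Nontriv (x ◃ y)} := by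
  ext x
  rw [hφ.mem_EE_iff, Set.mem_iInter]
  constructor
  · intro h n
    obtain ⟨e, he⟩ := exists_leftId (x.1 n)
    obtain ⟨e, rfl⟩ := exists_thread hφ.surjective n e
    obtain ⟨_, y, -, hy, h1⟩ := hφ.exists_act_notMem n x e
    exact ⟨y, hy ▸ he, h y h1.of_act⟩
  · rintro h r ⟨n, hn⟩
    obtain ⟨y, hy, h1⟩ := h n
    exact hφ.nontriv_act_of_mem hn hy h1

theorem IsVast.isGδ_EE (hφ : IsVast φ) : IsGδ (EE φ) := by
  rw [hφ.EE_eq]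
  exact .iInter fun n => (isOpen_exists_nontriv_act n).isGδ

theorem IsVast.dense_EE (hφ : IsVast φ) : Dense (EE φ) := by
  rw [hφ.EE_eq]
  refine dense_iInter_of_isOpen_nat isOpen_exists_nontriv_act fun n => dense_iff.2 fun x m => ?_
  obtain ⟨e, he⟩ := exists_leftId (x.1 (max n m))
  obtain ⟨e, rfl⟩ := exists_thread hφ.surjective _ e
  obtain ⟨x', y, hx, hy, h⟩ := hφ.exists_act_notMem (max n m) x e
  exact ⟨x', ⟨y, mem_leftIds_of_le hφ.surjective (le_max_left n m) (hy ▸ he), h⟩,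
    coord_eq_of_le (le_max_right n m) hx⟩

theorem IsVast.dense_EEPlus (hφ : IsVast φ) : Dense {x : EE φ | x.1 ∈ EEPlus φ} := by
  rw [Subtype.dense_iff]
  intro x hx
  suffices h : Dense (EEPlus φ) by
    refine closure_mono ?_ (h x)
    exact fun y hy => ⟨⟨y, hy.1⟩, hy, rfl⟩
  refine dense_iff.2 fun x n => ?_
  obtain ⟨_, y, -, hy, h⟩ := hφ.exists_act_notMem n x x
  obtain ⟨m, hm⟩ := h.of_act
  obtain ⟨z, hz, e⟩ := dense_iff.1 hφ.dense_EE y (max n m)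
  -- Approximating the nontrivial `y` to level `max n m` keeps both the prescribed coordinate and
  -- nontriviality.
  exact ⟨z, ⟨hz, m, coord_eq_of_le (le_max_right n m) e ▸ hm⟩,
    (coord_eq_of_le (le_max_left n m) e).trans hy⟩

/-! ### Acyclicity, freeness and composition. -/

/-- The sub-LD-system `EE⁺` of the inverse limit. -/
def IsVast.subEEPlus (hφ : IsVast φ) : SubLDSystem (InvLim φ) where
  carrier := EEPlus φ
  act_mem := hφ.act_mem_EEPlus

theorem IsVast.isAcyclic (hφ : IsVast φ) : IsAcyclic hφ.subEEPlus.carrier := by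
  intro x l hl e
  obtain ⟨p, hp⟩ : ∃ p, l.length = p + 1 := ⟨l.length - 1, by
    have := List.length_pos_iff.2 hl; omega⟩
  -- The cycle is unrolled periodically; the index stays below the length of `l`, so the default `x`
  -- is never used.
  let y : ℕ → hφ.subEEPlus.carrier := fun i => l.getD (i % (p + 1)) x
  let z : ℕ → hφ.subEEPlus.carrier := fun i => (l.take (i % (p + 1))).foldl (fun a b => a ◃ b) x
  have hstep : ∀ i, z (i + 1) = z i ◃ y i := by
    intro i
    have hi : i % (p + 1) < p + 1 := Nat.mod_lt _ p.succ_pos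
    have h1 : z i ◃ y i = (l.take (i % (p + 1) + 1)).foldl (fun a b => a ◃ b) x := by
      rw [List.take_add_one, List.foldl_append, List.getElem?_eq_getElem (by omega)]
      simp only [z, y, Option.toList_some, List.foldl_cons, List.foldl_nil]
      rw [List.getD_eq_getElem]
    rw [h1]
    change (l.take ((i + 1) % (p + 1))).foldl (fun a b => a ◃ b) x = _
    rw [← Nat.mod_add_mod]
    rcases (show i % (p + 1) + 1 ≤ p + 1 from hi).eq_or_lt with h | h
    · rw [h, Nat.mod_self, ← hp, List.take_length, e]; rfl
    · rw [Nat.mod_eq_of_lt h]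
  have hper : ∀ i, z (i + (p + 1)) = z i := fun i => by simp [z]
  -- Nontriviality persists to higher levels, so one level serves the whole cycle.
  have hz : ∃ m, ∀ i < p + 1, (z i).1.1 m ∉ leftIds (X m) := by
    choose m hm using fun i => (z i).2.2
    exact ⟨(Finset.range (p + 1)).sup m, fun i hi k => hm i
      (mem_leftIds_of_le hφ.surjective (Finset.le_sup (Finset.mem_range.2 hi)) k)⟩
  obtain ⟨m, hm⟩ := hz
  obtain ⟨i, hi⟩ := exists_mem_leftIds_of_cycle (fun i => (z i).1.1 m) (fun i => (y i).1.1 m)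
    (fun i => by rw [hstep]; rfl) p (fun i => by rw [hper])
  refine hm (i % (p + 1)) (Nat.mod_lt _ p.succ_pos) ?_
  have : z (i % (p + 1)) = z i := by simp [z]
  rwa [this]

theorem IsVast.freelyGenerates (hφ : IsVast φ) {x : InvLim φ} (hx : x ∈ EEPlus φ) :
    FreelyGenerates (fun _ : Unit => x) :=
  (hφ.isAcyclic.freelyGenerates ⟨x, hx⟩).comp hφ.subEEPlus.subtype Subtype.val_injective

/-- The composition of threads of reduced permutative LD-systems. -/
noncomputable def IsVast.compThread (hφ : IsVast φ) (hr : ∀ n, IsReduced (X n))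
    (x y : InvLim φ) : InvLim φ :=
  ⟨fun n => comp (x.1 n) (y.1 n), fun n => by
    rw [map_comp (hr _) (hr _) _ (hφ.surjective n), x.2, y.2]⟩

theorem IsVast.mem_EE_of_act_eq (hφ : IsVast φ) {x y z : InvLim φ} (hx : x ∈ EE φ)
    (hy : y ∈ EE φ) (h : ∀ w, z ◃ w = x ◃ (y ◃ w)) : z ∈ EE φ := by
  rw [hφ.mem_EE_iff] at *
  intro r hr
  rw [h]
  exact hx _ (hy r hr)

theorem IsVast.compThread_mem_EE (hφ : IsVast φ) (hr : ∀ n, IsReduced (X n))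
    {x y : InvLim φ} (hx : x ∈ EE φ) (hy : y ∈ EE φ) : hφ.compThread hr x y ∈ EE φ :=
  hφ.mem_EE_of_act_eq hx hy fun _ => Subtype.ext (funext fun _ => comp_act _ _ _)

/-- The sub-LD-monoid `EE` of the inverse limit. -/
def IsVast.subEE [∀ n, LDMonoid (X n)] [∀ n, IsLDMonoidHom (φ n)] (hφ : IsVast φ) :
    SubLDMonoid (InvLim φ) where
  carrier := EE φ
  act_mem := hφ.act_mem_EE
  one_mem := hφ.mem_EE_iff.2 fun r hr => by rwa [LDMonoid.one_act]
  mul_mem hx hy := hφ.mem_EE_of_act_eq hx hy fun _ => LDMonoid.mul_act _ _ _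

theorem IsVast.freelyGeneratesMon [∀ n, LDMonoid (X n)] [∀ n, IsLDMonoidHom (φ n)]
    (hφ : IsVast φ) (hr : ∀ n, IsReduced (X n)) (x : hφ.subEE.carrier) (hx : x ≠ 1) :
    FreelyGeneratesMon (fun _ : Unit => x) := by
  refine FreelyGenerates.freelyGeneratesMon
    (FreelyGenerates.of_comp hφ.subEE.toSubLDSystem.subtype (hφ.freelyGenerates ⟨x.2, ?_⟩))
  by_contra! h
  exact hx (Subtype.ext (Subtype.ext (funext fun n => (hr n).unique (h n) LDMonoid.one_act)))

end Inverse

end LD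

theorem mainTheorem9 {X : ℕ → Type u} [∀ n, Shelf (X n)] [∀ n, LD.IsPermutative (X n)]
    (φ : ∀ n, X (n + 1) →◃ X n) (hφ : LD.IsVast φ) :
    -- `EE` is a dense `G_δ` subset of the inverse limit
    (Dense (LD.EE φ) ∧ IsGδ (LD.EE φ)) ∧
    -- `EE⁺` is a dense open subset of `EE`
    (Dense {x : LD.EE φ | x.1 ∈ LD.EEPlus φ} ∧ IsOpen {x : LD.EE φ | x.1 ∈ LD.EEPlus φ}) ∧
    -- `EE` is closed under the self-distributive operation
    (∃ S : LD.SubLDSystem (LD.InvLim φ), S.carrier = LD.EE φ) ∧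
    -- `EE⁺` is closed under the self-distributive operation and is an acyclic LD-system in which
    -- every element freely generates a sub-LD-system
    (∃ S : LD.SubLDSystem (LD.InvLim φ), S.carrier = LD.EEPlus φ ∧
      LD.IsAcyclic S.carrier ∧
      ∀ x : S.carrier, LD.FreelyGenerates (fun _ : Unit => x)) ∧
    -- in the reduced case, `EE` and `EE⁺` are closed under composition
    ((∀ n, LD.IsReduced (X n)) →
      (∀ x ∈ LD.EE φ, ∀ y ∈ LD.EE φ, ∃ z ∈ LD.EE φ, ∀ n, z.1 n = LD.comp (x.1 n) (y.1 n)) ∧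
      (∀ x ∈ LD.EEPlus φ, ∀ y ∈ LD.EEPlus φ,
        ∃ z ∈ LD.EEPlus φ, ∀ n, z.1 n = LD.comp (x.1 n) (y.1 n))) ∧
    -- in the case of reduced permutative LD-monoids, `EE` is a sub-LD-monoid of the inverse limit
    -- in which every element other than `1` freely generates a sub-LD-monoid
    (∀ [∀ n, LD.LDMonoid (X n)] [∀ n, LD.IsLDMonoidHom (φ n)], (∀ n, LD.IsReduced (X n)) →
      ∃ M : LD.SubLDMonoid (LD.InvLim φ), M.carrier = LD.EE φ ∧
        ∀ x : M.carrier, x ≠ 1 → LD.FreelyGeneratesMon (fun _ : Unit => x)) := by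
  refine ⟨⟨hφ.dense_EE, hφ.isGδ_EE⟩, ⟨hφ.dense_EEPlus, ?_⟩,
    ⟨⟨LD.EE φ, hφ.act_mem_EE⟩, rfl⟩,
    ⟨hφ.subEEPlus, rfl, hφ.isAcyclic, fun x => hφ.isAcyclic.freelyGenerates x⟩,
    fun hr => ⟨fun x hx y hy => ⟨hφ.compThread hr x y, hφ.compThread_mem_EE hr hx hy,
      fun _ => rfl⟩, fun x hx y hy => ⟨hφ.compThread hr x y,
        ⟨hφ.compThread_mem_EE hr hx.1 hy.1, hx.2.imp fun n hn => LD.comp_notMem_leftIds _ hn⟩,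
        fun _ => rfl⟩⟩,
    fun hr => ⟨hφ.subEE, rfl, hφ.freelyGeneratesMon hr⟩⟩
  convert LD.isOpen_nontriv.preimage (continuous_subtype_val (p := fun x => x ∈ LD.EE φ)) using 1
  ext x
  exact and_iff_right x.2
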